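/- Let $w$ be a strictly positive analytic weight on the unit circle $\mathbb T=\{|z|=1\}$, and let $\varphi_n(z)=\kappa_n z^n+\cdots$, $\kappa_n>0$, be the orthonormal polynomials of the measure $w(z)\,|dz|$, that is, $\oint_{\mathbb T}\varphi_n\overline{\varphi_m}\,w\,|dz|=\delta_{mn}$. Put $\Phi_n=\varphi_n/\kappa_n$, and let $\alpha_n=-\overline{\Phi_{n+1}(0)}$ be the Verblunsky coefficients. Let $$D(w;z)=\exp\left(\frac1{4\pi}\int_0^{2\pi}\log w(e^{i\theta})\,\frac{e^{i\theta}+z}{e^{i\theta}-z}\,d\theta\right),\qquad |z|\neq1,$$ be the Szegő function, and write $D_{\rm i}$ and $D_{\rm e}$ for its values in $|z|<1$ and in $|z|>1$, respectively. Let $$\rho=\inf\{0<r<1:\ D_{\rm e}\text{ has a holomorphic continuation to }|z|>r\}.$$ Assume that there is $0\le\rho'<\rho$ such that $D_{\rm e}$ can be continued to $|z|>\rho'$ as a meromorphic function whose only singularities are on the circle $|z|=\rho$; the continuation is again denoted by $D_{\rm e}$. Call a pole $a$ of $D_{\rm e}$ dominant if for every other singularity $b$ of $D_{\rm e}$ in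 $|z|>\rho'$ either $|b|<|a|$, or $|b|=|a|$, $b$ is a pole and its multiplicity is at most that of $a$. Let $a_1,\dots,a_\ell$ be the (distinct) dominant poles of $D_{\rm e}$, let $m$ be their common multiplicity, and put $\widehat D_{\rm e}(a_k)=\lim_{z\to a_k}D_{\rm e}(z)(z-a_k)^m$. Then, as $n\to\infty$, $$\alpha_n=-\sum_{k=1}^{\ell}\binom{n+1}{m-1}\,\overline{a_k^{\,n-m+1}\,D_{\rm i}(w;a_k)\,\widehat D_{\rm e}(a_k)}+E_n,$$ where $E_n=O(\rho^n\delta^n)$ for some constant $0<\delta<1$ if $m=1$, and $E_n=O(n^{m-2}\rho^n)$ if $m\ge2$. -/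

import Mathlib

open Filter Topology Asymptotics ComplexConjugate Polynomial

noncomputable section

namespace Szego

/-- A strictly positive analytic weight on the unit circle: `w` is holomorphic in a neighbourhood
of the unit circle, and real and positive on the circle.  The associated measure is
`w(z) |dz|`. -/
structure IsAnalyticWeight (w : ℂ → ℂ) : Prop where
  analytic : AnalyticOnNhd ℂ w (Metric.sphere 0 1)
  im_eq_zero : ∀ z : ℂ, ‖z‖ = 1 → (w z).im = 0
  re_pos : ∀ z : ℂ, ‖z‖ = 1 → 0 < (w z).re

/-- The inner product `∮ P(z) conj(Q(z)) w(z) |dz|` over the unit circle. -/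
def circleInner (w : ℂ → ℂ) (P Q : ℂ[X]) : ℂ :=
  ∫ θ in (0 : ℝ)..2 * Real.pi,
    P.eval (circleMap 0 1 θ) * conj (Q.eval (circleMap 0 1 θ)) * w (circleMap 0 1 θ)

/-- `φ` is the sequence of orthonormal polynomials of the measure `w(z) |dz|`:
`φ n = κ_n z^n + lower degree terms` with `κ_n > 0`, and `∮ φ_n conj(φ_m) w |dz| = δ_{mn}`. -/
structure IsOrthonormalPolynomials (w : ℂ → ℂ) (φ : ℕ → ℂ[X]) : Prop where
  natDegree_eq : ∀ n, (φ n).natDegree = n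
  leadingCoeff_im : ∀ n, (φ n).leadingCoeff.im = 0
  leadingCoeff_pos : ∀ n, 0 < (φ n).leadingCoeff.re
  orthonormal : ∀ m n, circleInner w (φ n) (φ m) = if m = n then 1 else 0

/-- The monic orthogonal polynomials `Φ_n = φ_n / κ_n`. -/
def monicOP (φ : ℕ → ℂ[X]) (n : ℕ) : ℂ[X] :=
  C ((φ n).leadingCoeff)⁻¹ * φ n

/-- The Verblunsky coefficients `α_n = - conj(Φ_{n+1}(0))`. -/
def verblunsky (φ : ℕ → ℂ[X]) (n : ℕ) : ℂ :=
  -conj ((monicOP φ (n + 1)).eval 0)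

/-- The Szegő function
`D(w; z) = exp((1/4π) ∫_0^{2π} log w(e^{iθ}) (e^{iθ} + z)/(e^{iθ} - z) dθ)`, for `|z| ≠ 1`.
Its values for `|z| < 1` are those of `D_i`, its values for `|z| > 1` those of `D_e`. -/
def szegoFunction (w : ℂ → ℂ) (z : ℂ) : ℂ :=
  Complex.exp ((1 / (4 * (Real.pi : ℂ))) *
    ∫ θ in (0 : ℝ)..2 * Real.pi,
      (Real.log (w (circleMap 0 1 θ)).re : ℂ) *
        ((circleMap 0 1 θ + z) / (circleMap 0 1 θ - z)))

/-- `ρ = inf {0 < r < 1 : D_e(w; ·) is holomorphic in |z| > r}`, where being holomorphic in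
`|z| > r` means having a holomorphic continuation from `|z| > 1` to `|z| > r`. -/
def criticalRadius (w : ℂ → ℂ) : ℝ :=
  sInf {r : ℝ | 0 < r ∧ r < 1 ∧ ∃ g : ℂ → ℂ,
    DifferentiableOn ℂ g {z | r < ‖z‖} ∧ ∀ z : ℂ, 1 < ‖z‖ → g z = szegoFunction w z}

/-- `f` has a pole at `a`. -/
def IsPole (f : ℂ → ℂ) (a : ℂ) : Prop :=
  MeromorphicAt f a ∧ meromorphicOrderAt f a < 0

/-- The multiplicity of the pole `a` of `f`. -/
def poleMultiplicity (f : ℂ → ℂ) (a : ℂ) : ℕ :=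
  (-(meromorphicOrderAt f a).untop₀).toNat

/-- `b` is a (non-removable) singularity of `f`. -/
def IsSingularity (f : ℂ → ℂ) (b : ℂ) : Prop :=
  ¬ ∃ g : ℂ → ℂ, AnalyticAt ℂ g b ∧ f =ᶠ[𝓝[≠] b] g

/-- `a` is a dominant pole of `f` in the region `U`: for every other singularity `b` of `f`,
either `|a| > |b|`, or `|a| = |b|`, `b` is also a pole and its multiplicity does not exceed
that of `a`. -/
def IsDominantPole (f : ℂ → ℂ) (U : Set ℂ) (a : ℂ) : Prop :=
  a ∈ U ∧ IsPole f a ∧ ∀ b ∈ U, b ≠ a → IsSingularity f b →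
    ‖b‖ < ‖a‖ ∨ (‖b‖ = ‖a‖ ∧ IsPole f b ∧ poleMultiplicity f b ≤ poleMultiplicity f a)

/-- `De` continues the exterior Szegő function of `w` from `|z| > 1` to `|z| > ρ'` as a
meromorphic function whose only singularities are on the circle `|z| = ρ`. -/
structure IsMeromorphicContinuation (w : ℂ → ℂ) (ρ ρ' : ℝ) (De : ℂ → ℂ) : Prop where
  eq_szego : ∀ z : ℂ, 1 < ‖z‖ → De z = szegoFunction w z
  meromorphic : MeromorphicOn De {z | ρ' < ‖z‖}
  analytic : ∀ z : ℂ, ρ' < ‖z‖ → ‖z‖ ≠ ρ → AnalyticAt ℂ De z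

/-- The leading coefficient `lim_{z → a} f(z) (z - a)^m` of `f` at a pole `a` of
multiplicity `m`; the limit exists by `tendsto_polarCoeff`. -/
def polarCoeff (f : ℂ → ℂ) (m : ℕ) (a : ℂ) : ℂ :=
  limUnder (𝓝[≠] a) fun z => f z * (z - a) ^ m

theorem tendsto_polarCoeff {f : ℂ → ℂ} {a : ℂ} (h : IsPole f a) :
    Tendsto (fun z => f z * (z - a) ^ poleMultiplicity f a) (𝓝[≠] a)
      (𝓝 (polarCoeff f (poleMultiplicity f a) a)) := by
  obtain ⟨hm, hlt⟩ := h
  obtain ⟨k, hk⟩ := WithTop.ne_top_iff_exists.1 hlt.ne_top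
  have hk0 : k < 0 := by rw [← hk] at hlt; exact_mod_cast hlt
  obtain ⟨g, hg, -, hfg⟩ := (meromorphicOrderAt_eq_int_iff hm).1 hk.symm
  have hmul : ((poleMultiplicity f a : ℕ) : ℤ) = -k := by
    have h1 : (meromorphicOrderAt f a).untop₀ = k := by rw [← hk]; rfl
    rw [poleMultiplicity, h1]
    omega
  refine tendsto_nhds_limUnder ⟨g a, ?_⟩
  refine (hg.continuousAt.tendsto.mono_left nhdsWithin_le_nhds).congr' ?_
  filter_upwards [hfg, self_mem_nhdsWithin] with z hz hza
  have hne : z - a ≠ 0 := sub_ne_zero.2 hza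
  rw [hz, ← zpow_natCast, hmul, zpow_neg, smul_eq_mul]
  field_simp

/-! The orthonormal polynomials of an analytic weight exist. -/

theorem IsAnalyticWeight.continuous {w : ℂ → ℂ} (hw : IsAnalyticWeight w) :
    Continuous fun θ : ℝ => w (circleMap 0 1 θ) :=
  hw.analytic.continuousOn.comp_continuous (continuous_circleMap 0 1) fun θ => by simp

theorem circleInner_continuous {w : ℂ → ℂ} (hw : IsAnalyticWeight w) (P Q : ℂ[X]) :
    Continuous fun θ : ℝ => P.eval (circleMap 0 1 θ) * conj (Q.eval (circleMap 0 1 θ)) *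
      w (circleMap 0 1 θ) := by
  have h1 := continuous_circleMap (0 : ℂ) 1
  exact ((P.continuous.comp h1).mul
    (Complex.continuous_conj.comp (Q.continuous.comp h1))).mul hw.continuous

theorem circleInner_add_left {w : ℂ → ℂ} (hw : IsAnalyticWeight w) (P P' Q : ℂ[X]) :
    circleInner w (P + P') Q = circleInner w P Q + circleInner w P' Q := by
  rw [circleInner, circleInner, circleInner, ← intervalIntegral.integral_add
    ((circleInner_continuous hw P Q).intervalIntegrable _ _)
    ((circleInner_continuous hw P' Q).intervalIntegrable _ _)]
  congr 1; ext θ; simp; ring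

theorem circleInner_C_mul_left (w : ℂ → ℂ) (c : ℂ) (P Q : ℂ[X]) :
    circleInner w (C c * P) Q = c * circleInner w P Q := by
  rw [circleInner, circleInner, ← intervalIntegral.integral_const_mul]
  congr 1; ext θ; simp; ring

theorem circleInner_conj {w : ℂ → ℂ} (hw : IsAnalyticWeight w) (P Q : ℂ[X]) :
    conj (circleInner w P Q) = circleInner w Q P := by
  rw [circleInner, circleInner, intervalIntegral.integral_of_le Real.two_pi_pos.le,
    intervalIntegral.integral_of_le Real.two_pi_pos.le, ← integral_conj]
  congr 1; ext θ
  have : conj (w (circleMap 0 1 θ)) = w (circleMap 0 1 θ) :=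
    Complex.conj_eq_iff_im.2 (hw.im_eq_zero _ (by simp))
  simp only [map_mul, this, Complex.conj_conj]; ring

theorem circleInner_self_pos {w : ℂ → ℂ} (hw : IsAnalyticWeight w) {P : ℂ[X]} (hP : P ≠ 0) :
    ∃ r : ℝ, 0 < r ∧ circleInner w P P = r := by
  have key : ∀ θ : ℝ, P.eval (circleMap 0 1 θ) * conj (P.eval (circleMap 0 1 θ)) *
      w (circleMap 0 1 θ) =
      ((‖P.eval (circleMap 0 1 θ)‖ ^ 2 * (w (circleMap 0 1 θ)).re : ℝ) : ℂ) := by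
    intro θ
    have h1 : w (circleMap 0 1 θ) = ((w (circleMap 0 1 θ)).re : ℂ) :=
      Complex.ext rfl (by simpa using hw.im_eq_zero _ (by simp))
    rw [Complex.mul_conj, Complex.normSq_eq_norm_sq]
    conv_lhs => rw [h1]
    push_cast; rfl
  refine ⟨∫ θ in (0 : ℝ)..2 * Real.pi,
    ‖P.eval (circleMap 0 1 θ)‖ ^ 2 * (w (circleMap 0 1 θ)).re, ?_, ?_⟩
  · refine intervalIntegral.integral_pos Real.two_pi_pos ?_ ?_ ?_
    · exact Continuous.continuousOn ((((P.continuous.comp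
        (continuous_circleMap 0 1)).norm).pow 2).mul
        (Complex.continuous_re.comp hw.continuous))
    · intro θ _
      exact mul_nonneg (by positivity) (hw.re_pos _ (by simp)).le
    · by_contra! hcon
      have hz : ∀ θ ∈ Set.Ico (0 : ℝ) (2 * Real.pi), P.eval (circleMap 0 1 θ) = 0 := by
        intro θ hθ
        have h2 := hcon θ ⟨hθ.1, hθ.2.le⟩
        have h3 := hw.re_pos (circleMap 0 1 θ) (by simp)
        by_contra hne
        have : 0 < ‖P.eval (circleMap 0 1 θ)‖ ^ 2 := by positivity
        nlinarith [mul_pos this h3]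
      refine hP (Polynomial.eq_zero_of_infinite_isRoot P ?_)
      refine Set.Infinite.mono (s := circleMap 0 1 '' Set.Ico (0 : ℝ) (2 * Real.pi)) ?_ ?_
      · rintro _ ⟨θ, hθ, rfl⟩
        exact hz θ hθ
      · refine (Set.Ico_infinite Real.two_pi_pos).image ?_
        exact injOn_circleMap_of_abs_sub_le' one_ne_zero (by simp)
  · rw [circleInner, ← intervalIntegral.integral_ofReal]
    congr 1; ext θ; exact key θ

theorem exists_orthogonal_projection {w : ℂ → ℂ} (hw : IsAnalyticWeight w) (n : ℕ) :
    ∀ P : ℂ[X], ∃ Q : ℂ[X], Q.degree < n ∧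
      ∀ R : ℂ[X], R.degree < n → circleInner w (P + Q) R = 0 := by
  induction n with
  | zero =>
    intro P
    refine ⟨0, by simp, fun R hR => ?_⟩
    have : R = 0 := by simpa using hR
    simp [this, circleInner]
  | succ n ih =>
    intro P
    obtain ⟨Q, hQ, hQo⟩ := ih P
    obtain ⟨T, hT, hTo⟩ := ih (X ^ n)
    have hmon : (X ^ n + T).Monic := monic_X_pow_add hT
    have hdeg : (X ^ n + T).degree = (n : WithBot ℕ) := by
      rw [degree_add_eq_left_of_degree_lt (by rwa [degree_X_pow]), degree_X_pow]
    obtain ⟨r, hr, hrr⟩ := circleInner_self_pos hw hmon.ne_zero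
    have hlt : (n : WithBot ℕ) < ((n + 1 : ℕ) : WithBot ℕ) := by exact_mod_cast Nat.lt_succ_self n
    refine ⟨Q + C (-(circleInner w (P + Q) (X ^ n + T) / r)) * (X ^ n + T), ?_, ?_⟩
    · refine (degree_add_le _ _).trans_lt (max_lt (hQ.trans hlt) ?_)
      rw [← smul_eq_C_mul]
      refine (degree_smul_le _ _).trans_lt ?_
      rw [hdeg]; exact hlt
    · intro R hR
      set S := R + C (-(R.coeff n)) * (X ^ n + T) with hS
      have hSdeg : S.degree < n := by
        rw [degree_lt_iff_coeff_zero]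
        intro k hk
        rcases hk.eq_or_lt with rfl | hk
        · have : (X ^ n + T).coeff n = 1 := by
            have := hmon.coeff_natDegree
            rwa [natDegree_eq_of_degree_eq_some hdeg] at this
          rw [hS, coeff_add, coeff_C_mul, this]; ring
        · have h1 : R.coeff k = 0 := (degree_lt_iff_coeff_zero R (n + 1)).1 hR k hk
          have h2 : (X ^ n + T).coeff k = 0 :=
            coeff_eq_zero_of_degree_lt (by rw [hdeg]; exact_mod_cast hk)
          rw [hS, coeff_add, coeff_C_mul, h1, h2]; ring
      have hR' : R = C (R.coeff n) * (X ^ n + T) + S := by rw [hS, C_neg]; ring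
      have hlin : ∀ A : ℂ[X], circleInner w A R =
          conj (R.coeff n) * circleInner w A (X ^ n + T) + circleInner w A S := by
        intro A
        conv_lhs => rw [hR']
        rw [← circleInner_conj hw, circleInner_add_left hw, circleInner_C_mul_left, map_add,
          map_mul, circleInner_conj hw, circleInner_conj hw]
      have hr' : (r : ℂ) ≠ 0 := by exact_mod_cast hr.ne'
      rw [hlin, ← add_assoc, circleInner_add_left hw, circleInner_add_left hw (P + Q),
        circleInner_C_mul_left, circleInner_C_mul_left, hrr, hQo S hSdeg, hTo S hSdeg]
      field_simp
      ring

theorem exists_isOrthonormalPolynomials {w : ℂ → ℂ} (hw : IsAnalyticWeight w) :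
    ∃ φ : ℕ → ℂ[X], IsOrthonormalPolynomials w φ := by
  choose T hT hTo using fun n : ℕ => exists_orthogonal_projection hw n (X ^ n)
  have hmon : ∀ n, (X ^ n + T n).Monic := fun n => monic_X_pow_add (hT n)
  have hdeg : ∀ n : ℕ, (X ^ n + T n).degree = (n : WithBot ℕ) := fun n => by
    rw [degree_add_eq_left_of_degree_lt (by rw [degree_X_pow]; exact hT n), degree_X_pow]
  choose r hr hrr using fun n : ℕ => circleInner_self_pos hw (hmon n).ne_zero
  have hs : ∀ n, 0 < (√(r n))⁻¹ := fun n => inv_pos.2 (Real.sqrt_pos.2 (hr n))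
  have hs' : ∀ n, (((√(r n))⁻¹ : ℝ) : ℂ) ≠ 0 := fun n => by exact_mod_cast (hs n).ne'
  have hlead : ∀ n, (C (((√(r n))⁻¹ : ℝ) : ℂ) * (X ^ n + T n)).leadingCoeff =
      (((√(r n))⁻¹ : ℝ) : ℂ) := fun n => by
    rw [leadingCoeff_mul, leadingCoeff_C, (hmon n).leadingCoeff, mul_one]
  have hinner : ∀ m n, circleInner w (C (((√(r n))⁻¹ : ℝ) : ℂ) * (X ^ n + T n))
      (C (((√(r m))⁻¹ : ℝ) : ℂ) * (X ^ m + T m)) =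
      (((√(r n))⁻¹ : ℝ) : ℂ) * ((((√(r m))⁻¹ : ℝ) : ℂ) *
        circleInner w (X ^ n + T n) (X ^ m + T m)) := fun m n => by
    rw [circleInner_C_mul_left, ← circleInner_conj hw, circleInner_C_mul_left, map_mul,
      circleInner_conj hw, Complex.conj_ofReal]
  have hlt : ∀ m n, m < n → circleInner w (X ^ n + T n) (X ^ m + T m) = 0 := fun m n h =>
    hTo n _ (by rw [hdeg]; exact_mod_cast h)
  refine ⟨fun n => C (((√(r n))⁻¹ : ℝ) : ℂ) * (X ^ n + T n), ?_, ?_, ?_, ?_⟩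
  · intro n
    rw [natDegree_C_mul (hs' n)]
    exact natDegree_eq_of_degree_eq_some (hdeg n)
  · intro n
    rw [hlead]; exact Complex.ofReal_im _
  · intro n
    rw [hlead, Complex.ofReal_re]; exact hs n
  · intro m n
    rw [hinner]
    rcases lt_trichotomy m n with h | rfl | h
    · rw [hlt m n h, if_neg h.ne]; ring
    · rw [hrr, if_pos rfl]
      norm_cast
      have h1 := Real.mul_self_sqrt (hr m).le
      have h2 := (Real.sqrt_pos.2 (hr m)).ne'
      field_simp
      nlinarith
    · rw [← circleInner_conj hw, hlt n m h, if_neg h.ne', map_zero]; ring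

end Szego

end

noncomputable section

namespace Szego

/-! Let F be `interiorReciprocal`, that is 1/D_i in the disc. The reflection D(1/conj z) =
1/conj(D(z)) continues F by conj(D_e(1/conj z)) to |z| < 1/ρ, and |F|² w = 1 on the circle.

The reversed polynomial Φ_n* is orthogonal to z, ..., z^n. So is F, because conj(F) w = 1/F on the
circle and the mean value property applies. Both Φ_n* and F/F(0) equal 1 at the origin. Comparison
with Taylor polynomials of F therefore gives an L²(w) error O(r^n) for Φ_n* - F/F(0), for every r in
(ρ, 1). In the formula for Φ_n(0) obtained by pairing Φ_n with F, this error meets only the Taylor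
error of F, also O(r^n). Hence Φ_n(0) is the mean of z^n conj(F)/F up to O(r^(2n))
(`isBigO_monicOP_eval_zero`), and r can be chosen with r² < ρ.

Since conj(F) = D_e on the circle, conj(α_n) is, up to sign and that error, (1/2πi)∮ z^n D_i D_e dz
(`isBigO_verblunsky_sub`). Split D_e into principal parts at its poles and a remainder R holomorphic
in |z| > ρ' (`exists_eq_add_principalParts`). Shrinking the contour makes the contribution of R of
order s^n with s < ρ (`isBigO_circleIntegral_pow_mul`). The principal parts give residues of z^n
D_i(z) (z - a)^(-j): for a simple pole the residue is exactly the stated term, for higher order the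
leading binomial term is found by Pascal's rule and the rest loses a factor n
(`isBigO_polarMoment_sub`). All singularities lie on |z| = ρ, so dominant poles are those of maximal
multiplicity (`IsMeromorphicContinuation.dominantPoles`), and the other poles enter the error only.
-/

/-! ### The Szegő function: reflection in the circle and radial boundary values. -/

theorem szegoFunction_eq_exp_circleAverage (w : ℂ → ℂ) (z : ℂ) :
    szegoFunction w z = Complex.exp (Real.circleAverage
      (fun ζ => herglotzRieszKernel 0 z ζ • ((Real.log (w ζ).re : ℝ) : ℂ)) 0 1 / 2) := by
  rw [szegoFunction, Real.circleAverage_def]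
  congr 1
  have h : ∀ θ : ℝ, ((Real.log (w (circleMap 0 1 θ)).re : ℝ) : ℂ) *
      ((circleMap 0 1 θ + z) / (circleMap 0 1 θ - z)) =
      herglotzRieszKernel 0 z (circleMap 0 1 θ) •
        ((Real.log (w (circleMap 0 1 θ)).re : ℝ) : ℂ) := fun θ => by
    rw [herglotzRieszKernel_def]; simp [mul_comm]
  simp only [h]
  rw [Complex.real_smul]
  push_cast
  have : (Real.pi : ℂ) ≠ 0 := by exact_mod_cast Real.pi_ne_zero
  field_simp
  ring

theorem szegoFunction_ne_zero (w : ℂ → ℂ) (z : ℂ) : szegoFunction w z ≠ 0 :=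
  Complex.exp_ne_zero _

theorem IsAnalyticWeight.continuousOn_log {w : ℂ → ℂ} (hw : IsAnalyticWeight w) :
    ContinuousOn (fun ζ => Real.log (w ζ).re) (Metric.sphere 0 1) :=
  (Complex.continuous_re.comp_continuousOn hw.analytic.continuousOn).log
    fun z hz => (hw.re_pos z (by simpa using hz)).ne'

theorem IsAnalyticWeight.circleIntegrable_log {w : ℂ → ℂ} (hw : IsAnalyticWeight w) :
    CircleIntegrable (fun ζ => Real.log (w ζ).re) 0 1 :=
  hw.continuousOn_log.circleIntegrable zero_le_one

theorem szegoFunction_differentiableOn {w : ℂ → ℂ} (hw : IsAnalyticWeight w) :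
    DifferentiableOn ℂ (szegoFunction w) (Metric.ball 0 1) := by
  have h : szegoFunction w = fun z => Complex.exp (Real.circleAverage
      (fun ζ => herglotzRieszKernel 0 z ζ •
        ((Real.log (w ζ).re : ℝ) : ℂ)) 0 1 / 2) :=
    funext (szegoFunction_eq_exp_circleAverage w)
  rw [h]
  refine ((differentiableOn_circleAverage_herglotzRieszKernel_smul
    ?_).div_const _).cexp
  exact (Complex.continuous_ofReal.comp_continuousOn hw.continuousOn_log).circleIntegrable
    zero_le_one

/-- For |e| = 1, the kernel (e + z)/(e - z) goes to minus its conjugate when z is replaced by 1/conj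
z, and log w is real. -/
theorem szegoFunction_conj_inv (w : ℂ → ℂ) {z : ℂ} (hz : z ≠ 0) (hz1 : ‖z‖ ≠ 1) :
    szegoFunction w (conj z)⁻¹ = (conj (szegoFunction w z))⁻¹ := by
  rw [szegoFunction, szegoFunction, ← Complex.exp_conj, ← Complex.exp_neg, map_mul,
    ← intervalIntegral.intervalIntegral_conj, ← mul_neg, ← intervalIntegral.integral_neg]
  have h4 : conj (1 / (4 * (Real.pi : ℂ))) = 1 / (4 * (Real.pi : ℂ)) := by
    rw [show (1 / (4 * (Real.pi : ℂ))) = ((1 / (4 * Real.pi) : ℝ) : ℂ) by push_cast; rfl,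
      Complex.conj_ofReal]
  rw [h4]
  congr 2
  refine intervalIntegral.integral_congr fun θ _ => ?_
  simp only [map_mul, map_div₀, map_add, map_sub, Complex.conj_ofReal]
  rw [← mul_neg]
  congr 1
  set e := circleMap 0 1 θ
  have he : ‖e‖ = 1 := by simp [e]
  have he0 : e ≠ 0 := by rw [← norm_ne_zero_iff, he]; exact one_ne_zero
  have hee : conj e = e⁻¹ := by
    rw [Complex.inv_def, Complex.normSq_eq_norm_sq, he]; simp
  have hcz : conj z ≠ 0 := by simpa using hz
  have h1 : e * conj z - 1 ≠ 0 := by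
    intro h
    have : ‖e * conj z‖ = 1 := by rw [sub_eq_zero.1 h]; simp
    rw [norm_mul, he, RCLike.norm_conj, one_mul] at this
    exact hz1 this
  have h2 : 1 - e * conj z ≠ 0 := by rw [← neg_sub]; exact neg_ne_zero.2 h1
  have h3 : e - (conj z)⁻¹ ≠ 0 := by
    have : e - (conj z)⁻¹ = (e * conj z - 1) / conj z := by field_simp
    rw [this]; exact div_ne_zero h1 hcz
  have h5 : e⁻¹ - conj z ≠ 0 := by
    have : e⁻¹ - conj z = (1 - e * conj z) / e := by field_simp
    rw [this]; exact div_ne_zero h2 he0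
  rw [hee, ← neg_div, div_eq_div_iff h3 h5]
  field_simp
  ring

theorem IsAnalyticWeight.norm_szegoFunction_sq {w : ℂ → ℂ} (hw : IsAnalyticWeight w) {z : ℂ}
    (hz : z ∈ Metric.ball (0 : ℂ) 1) :
    ‖szegoFunction w z‖ ^ 2 = Real.exp (Real.circleAverage
      (fun ζ => poissonKernel 0 z ζ * Real.log (w ζ).re) 0 1) := by
  rw [szegoFunction_eq_exp_circleAverage, Complex.norm_exp, ← Real.exp_nat_mul]
  congr 1
  have h := re_circleAverage_herglotzRieszKernel_smul
    hw.circleIntegrable_log hz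
  have h2 : ∀ c : ℂ, (c / 2).re = c.re / 2 := fun c => by simp
  rw [h2, h, ← poissonKernel_eq_re_herglotzRieszKernel]
  push_cast
  rw [mul_div_cancel₀ _ two_ne_zero]
  rfl

theorem circleAverage_poissonKernel {z : ℂ} (hz : z ∈ Metric.ball (0 : ℂ) 1) :
    Real.circleAverage (poissonKernel 0 z) 0 1 = 1 := by
  have h := InnerProductSpace.HarmonicOnNhd.circleAverage_poissonKernel_smul
    (f := fun _ => (1 : ℝ)) (c := 0) (R := 1)
    (fun x _ => InnerProductSpace.harmonicAt_const 1) hz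
  rwa [show (poissonKernel 0 z • fun _ => (1 : ℝ)) = poissonKernel 0 z from mul_one _] at h

/-- Differentiability gives the estimate near ζ; away from ζ the distance is bounded below and v is
bounded on the compact set. -/
theorem exists_abs_sub_le_of_differentiableAt {v : ℂ → ℝ} {K : Set ℂ} (hK : IsCompact K)
    (hv : ContinuousOn v K) {ζ : ℂ} (hd : DifferentiableAt ℝ v ζ) :
    ∃ L : ℝ, 0 ≤ L ∧ ∀ e ∈ K, |v e - v ζ| ≤ L * ‖e - ζ‖ := by
  obtain ⟨C, hC⟩ := hd.isBigO_sub.bound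
  obtain ⟨ε, hε, hball⟩ := Metric.eventually_nhds_iff.1 hC
  obtain ⟨M, hM⟩ := hK.exists_bound_of_continuousOn hv
  refine ⟨max C 0 + (max M 0 + |v ζ|) / ε, by positivity, fun e he => ?_⟩
  by_cases h : dist e ζ < ε
  · refine (hball h).trans ?_
    gcongr
    exact (le_max_left _ _).trans (le_add_of_nonneg_right (by positivity))
  · push Not at h
    rw [dist_eq_norm] at h
    calc |v e - v ζ| ≤ |v e| + |v ζ| := abs_sub _ _
      _ ≤ max M 0 + |v ζ| := by gcongr; exact (hM e he).trans (le_max_left _ _)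
      _ = (max M 0 + |v ζ|) / ε * ε := by field_simp
      _ ≤ (max M 0 + |v ζ|) / ε * ‖e - ζ‖ := by gcongr
      _ ≤ _ := by gcongr; exact le_add_of_nonneg_left (by positivity)

/-- The Lipschitz bound at ζ cancels one factor of the singular denominator of the Poisson kernel,
so the integrands are uniformly bounded and dominated convergence applies. -/
theorem tendsto_circleAverage_poissonKernel_mul {v : ℂ → ℝ}
    (hv : ContinuousOn v (Metric.sphere 0 1)) {ζ : ℂ} (hζ : ‖ζ‖ = 1)
    (hd : DifferentiableAt ℝ v ζ) :
    Tendsto (fun r : ℝ => Real.circleAverage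
      (fun e => poissonKernel 0 (r * ζ) e * v e) 0 1) (𝓝[<] 1)
      (𝓝 (v ζ)) := by
  obtain ⟨L, hL0, hL⟩ := exists_abs_sub_le_of_differentiableAt (isCompact_sphere 0 1) hv hd
  have hr01 : ∀ᶠ r : ℝ in 𝓝[<] 1, r ∈ Set.Ioo (0 : ℝ) 1 := Ioo_mem_nhdsLT one_pos
  have hmem : ∀ r ∈ Set.Ioo (0 : ℝ) 1, (r * ζ : ℂ) ∈ Metric.ball (0 : ℂ) 1 := fun r hr => by
    simp [hζ, abs_of_pos hr.1, hr.2]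
  have hcont : ∀ r ∈ Set.Ioo (0 : ℝ) 1,
      ContinuousOn (poissonKernel 0 (r * ζ)) (Metric.sphere 0 1) := by
    intro r hr
    rw [poissonKernel_eq_re_herglotzRieszKernel]
    have := continuousOn_herglotzRieszKernel_sphere (hmem r hr)
    rw [abs_one] at this
    exact Complex.continuous_re.comp_continuousOn this
  have hcont2 : ∀ r ∈ Set.Ioo (0 : ℝ) 1, ContinuousOn
      (fun e => poissonKernel 0 (r * ζ) e * (v e - v ζ))
      (Metric.sphere 0 1) := fun r hr => (hcont r hr).mul (hv.sub continuousOn_const)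
  have hsplit : ∀ᶠ r : ℝ in 𝓝[<] 1, Real.circleAverage
      (fun e => poissonKernel 0 (r * ζ) e * (v e - v ζ)) 0 1 + v ζ =
      Real.circleAverage
      (fun e => poissonKernel 0 (r * ζ) e * v e) 0 1 := by
    filter_upwards [hr01] with r hr
    have h1 : (fun e => poissonKernel 0 (r * ζ) e * v e) =
        fun e => poissonKernel 0 (r * ζ) e * (v e - v ζ) +
          v ζ • poissonKernel 0 (r * ζ) e := by
      ext e; simp; ring
    have hint : CircleIntegrable (fun e => v ζ • poissonKernel 0 (r * ζ) e) 0 1 :=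
      ((hcont r hr).const_smul (v ζ)).circleIntegrable zero_le_one
    rw [h1, Real.circleAverage_fun_add ((hcont2 r hr).circleIntegrable zero_le_one) hint,
      Real.circleAverage_fun_smul, circleAverage_poissonKernel (hmem r hr)]
    simp
  refine Tendsto.congr' hsplit ?_
  rw [show 𝓝 (v ζ) = 𝓝 (0 + v ζ) by rw [zero_add]]
  refine Tendsto.add ?_ tendsto_const_nhds
  simp only [Real.circleAverage_def]
  suffices Tendsto (fun r : ℝ => ∫ θ in (0 : ℝ)..2 * Real.pi,
      poissonKernel 0 (r * ζ) (circleMap 0 1 θ) * (v (circleMap 0 1 θ) - v ζ)) (𝓝[<] 1)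
      (𝓝 (∫ _ in (0 : ℝ)..2 * Real.pi, (0 : ℝ))) by
    simpa using this.const_smul (2 * Real.pi)⁻¹
  have key : ∀ r ∈ Set.Ioo (0 : ℝ) 1, ∀ θ : ℝ, 1 - r ≤ ‖circleMap 0 1 θ - r * ζ‖ ∧
      ‖poissonKernel 0 (r * ζ) (circleMap 0 1 θ) *
        (v (circleMap 0 1 θ) - v ζ)‖ ≤
      (1 - r ^ 2) / ‖circleMap 0 1 θ - r * ζ‖ ^ 2 * (L * ‖circleMap 0 1 θ - ζ‖) := by
    intro r hr θ
    have hnr : ‖(r * ζ : ℂ)‖ = r := by simp [hζ, abs_of_pos hr.1]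
    have h1 : ‖circleMap 0 1 θ‖ = 1 := by simp
    refine ⟨?_, ?_⟩
    · have := norm_sub_norm_le (circleMap 0 1 θ) (r * ζ)
      rwa [h1, hnr] at this
    · rw [norm_mul, poissonKernel_def, sub_zero, sub_zero, h1, hnr, one_pow, Real.norm_eq_abs, Real.norm_eq_abs, abs_of_nonneg
        (div_nonneg (by nlinarith [hr.1, hr.2]) (by positivity))]
      have : (0 : ℝ) ≤ 1 - r ^ 2 := by nlinarith [hr.1, hr.2]
      gcongr
      exact hL _ (by simp)
  refine intervalIntegral.tendsto_integral_filter_of_dominated_convergence (fun _ => 4 * L)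
    ?_ ?_ intervalIntegrable_const ?_
  · filter_upwards [hr01] with r hr
    exact ((hcont2 r hr).comp_continuous (continuous_circleMap 0 1)
      fun θ => by simp).aestronglyMeasurable
  · filter_upwards [hr01] with r hr
    refine Eventually.of_forall fun θ _ => ((key r hr θ).2).trans ?_
    have h1 := (key r hr θ).1
    set d := ‖circleMap 0 1 θ - r * ζ‖
    -- From d ≥ 1 - r follow 1 - r² ≤ 2d and |e - ζ| ≤ d + (1 - r) ≤ 2d, whence the constant 4L.
    have hd0 : 0 < d := lt_of_lt_of_le (by linarith [hr.2]) h1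
    have h2 : ‖circleMap 0 1 θ - ζ‖ ≤ 2 * d := by
      have h3 : ‖(r * ζ : ℂ) - ζ‖ = 1 - r := by
        rw [show (r * ζ : ℂ) - ζ = ((r - 1 : ℝ) : ℂ) * ζ by push_cast; ring, norm_mul, hζ,
          Complex.norm_real, Real.norm_eq_abs, abs_of_neg (by linarith [hr.2])]
        ring
      have := norm_sub_le_norm_sub_add_norm_sub (circleMap 0 1 θ) (r * ζ : ℂ) ζ
      rw [h3] at this
      linarith
    calc (1 - r ^ 2) / d ^ 2 * (L * ‖circleMap 0 1 θ - ζ‖)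
        ≤ (2 * d) / d ^ 2 * (L * (2 * d)) := by
          gcongr
          nlinarith [hr.1, hr.2]
      _ = 4 * L := by field_simp; ring
  · refine Eventually.of_forall fun θ _ => ?_
    by_cases hθ : circleMap 0 1 θ = ζ
    · simp [hθ]
    · refine squeeze_zero_norm' (hr01.mono fun r hr => (key r hr θ).2) ?_
      have hne : ‖circleMap 0 1 θ - ((1 : ℝ) : ℂ) * ζ‖ ^ 2 ≠ 0 := by
        simpa [sub_eq_zero] using hθ
      have hc : ContinuousAt (fun r : ℝ => (1 - r ^ 2) / ‖circleMap 0 1 θ - (r : ℂ) * ζ‖ ^ 2 *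
          (L * ‖circleMap 0 1 θ - ζ‖)) 1 := by
        refine ContinuousAt.mul (ContinuousAt.div (by fun_prop) ?_ hne) continuousAt_const
        fun_prop
      have := hc.tendsto
      simp only [one_pow, sub_self, zero_div, zero_mul] at this
      exact this.mono_left nhdsWithin_le_nhds

theorem tendsto_norm_szegoFunction_sq {w : ℂ → ℂ} (hw : IsAnalyticWeight w) {ζ : ℂ}
    (hζ : ‖ζ‖ = 1) :
    Tendsto (fun r : ℝ => ‖szegoFunction w (r * ζ)‖ ^ 2) (𝓝[<] 1) (𝓝 (w ζ).re) := by
  have hpos := hw.re_pos ζ hζ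
  have hd : DifferentiableAt ℝ (fun e => Real.log (w e).re) ζ := by
    have h1 : DifferentiableAt ℝ w ζ :=
      ((hw.analytic ζ (by simpa using hζ)).differentiableAt).restrictScalars ℝ
    exact (Complex.reCLM.differentiableAt.comp ζ h1).log hpos.ne'
  have h := (Real.continuous_exp.tendsto _).comp
    (tendsto_circleAverage_poissonKernel_mul hw.continuousOn_log hζ hd)
  rw [Real.exp_log hpos] at h
  refine h.congr' ?_
  filter_upwards [Ioo_mem_nhdsLT (zero_lt_one' ℝ)] with r hr
  rw [hw.norm_szegoFunction_sq (by simp [hζ, abs_of_pos hr.1, hr.2])]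
  rfl

theorem szegoFunction_zero_pos (w : ℂ → ℂ) :
    ∃ c : ℝ, 0 < c ∧ szegoFunction w 0 = c := by
  refine ⟨Real.exp ((1 / (4 * Real.pi)) * ∫ θ in (0 : ℝ)..2 * Real.pi,
    Real.log (w (circleMap 0 1 θ)).re), Real.exp_pos _, ?_⟩
  rw [szegoFunction]
  push_cast
  rw [← intervalIntegral.integral_ofReal]
  congr 2
  refine intervalIntegral.integral_congr fun θ _ => ?_
  have : circleMap 0 1 θ ≠ 0 := circleMap_ne_center one_ne_zero
  simp [this]

/-! ### The weighted L² form on the circle. -/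

/-- The sesquilinear form `∫ f conj(g) w dθ` on functions of the angle. -/
def angleInner (w : ℂ → ℂ) (f g : ℝ → ℂ) : ℂ :=
  ∫ θ in (0 : ℝ)..2 * Real.pi, f θ * conj (g θ) * w (circleMap 0 1 θ)

/-- The boundary values of a function on the unit circle, as a function of the angle. -/
def onCircle (f : ℂ → ℂ) (θ : ℝ) : ℂ := f (circleMap 0 1 θ)

/-- The squared norm `∫ |f|² w dθ`. -/
def angleNormSq (w : ℂ → ℂ) (f : ℝ → ℂ) : ℝ :=
  ∫ θ in (0 : ℝ)..2 * Real.pi, ‖f θ‖ ^ 2 * (w (circleMap 0 1 θ)).re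

theorem continuous_onCircle {f : ℂ → ℂ} (hf : ContinuousOn f (Metric.sphere 0 1)) :
    Continuous (onCircle f) :=
  hf.comp_continuous (continuous_circleMap 0 1) fun θ => by simp

theorem continuous_onCircle_eval (P : ℂ[X]) : Continuous (onCircle fun z => P.eval z) :=
  continuous_onCircle P.continuous.continuousOn

theorem IsAnalyticWeight.coe_re {w : ℂ → ℂ} (hw : IsAnalyticWeight w) (θ : ℝ) :
    (((w (circleMap 0 1 θ)).re : ℝ) : ℂ) = w (circleMap 0 1 θ) :=
  Complex.ext rfl (by simpa using (hw.im_eq_zero _ (by simp)).symm)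

theorem continuous_angleInner_integrand {w : ℂ → ℂ} (hw : IsAnalyticWeight w) {f g : ℝ → ℂ}
    (hf : Continuous f) (hg : Continuous g) :
    Continuous fun θ => f θ * conj (g θ) * w (circleMap 0 1 θ) :=
  (hf.mul (Complex.continuous_conj.comp hg)).mul hw.continuous

theorem angleInner_sub_left {w : ℂ → ℂ} (hw : IsAnalyticWeight w) {f f' g : ℝ → ℂ}
    (hf : Continuous f) (hf' : Continuous f') (hg : Continuous g) :
    angleInner w (fun θ => f θ - f' θ) g = angleInner w f g - angleInner w f' g := by
  rw [angleInner, angleInner, angleInner, ← intervalIntegral.integral_sub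
    ((continuous_angleInner_integrand hw hf hg).intervalIntegrable _ _)
    ((continuous_angleInner_integrand hw hf' hg).intervalIntegrable _ _)]
  congr 1; ext θ; ring

theorem angleInner_const_mul_left (w : ℂ → ℂ) (c : ℂ) (f g : ℝ → ℂ) :
    angleInner w (fun θ => c * f θ) g = c * angleInner w f g := by
  rw [angleInner, angleInner, ← intervalIntegral.integral_const_mul]
  congr 1; ext θ; ring

theorem angleInner_conj {w : ℂ → ℂ} (hw : IsAnalyticWeight w) (f g : ℝ → ℂ) :
    conj (angleInner w f g) = angleInner w g f := by
  rw [angleInner, angleInner, ← intervalIntegral.intervalIntegral_conj]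
  congr 1; ext θ
  simp only [map_mul, Complex.conj_conj]
  rw [← hw.coe_re θ, Complex.conj_ofReal]
  ring

theorem angleInner_sub_right {w : ℂ → ℂ} (hw : IsAnalyticWeight w) {f g g' : ℝ → ℂ}
    (hf : Continuous f) (hg : Continuous g) (hg' : Continuous g') :
    angleInner w f (fun θ => g θ - g' θ) = angleInner w f g - angleInner w f g' := by
  rw [← angleInner_conj hw, angleInner_sub_left hw hg hg' hf, map_sub, angleInner_conj hw,
    angleInner_conj hw]

theorem angleInner_self {w : ℂ → ℂ} (hw : IsAnalyticWeight w) (f : ℝ → ℂ) :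
    angleInner w f f = (angleNormSq w f : ℂ) := by
  rw [angleInner, angleNormSq, ← intervalIntegral.integral_ofReal]
  congr 1; ext θ
  rw [Complex.mul_conj, Complex.normSq_eq_norm_sq, ← hw.coe_re θ, Complex.ofReal_re]
  push_cast; ring

theorem angleNormSq_nonneg {w : ℂ → ℂ} (hw : IsAnalyticWeight w) (f : ℝ → ℂ) :
    0 ≤ angleNormSq w f :=
  intervalIntegral.integral_nonneg Real.two_pi_pos.le fun θ _ =>
    mul_nonneg (by positivity) (hw.re_pos _ (by simp)).le

theorem continuous_angleNormSq_integrand {w : ℂ → ℂ} (hw : IsAnalyticWeight w) {f : ℝ → ℂ}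
    (hf : Continuous f) : Continuous fun θ => ‖f θ‖ ^ 2 * (w (circleMap 0 1 θ)).re :=
  (hf.norm.pow 2).mul (Complex.continuous_re.comp hw.continuous)

/-- The pointwise inequality 2|fg| ≤ |f|² + |g|² replaces Cauchy–Schwarz; it loses nothing here
because the two functions it is used for have errors of the same order. -/
theorem norm_angleInner_le {w : ℂ → ℂ} (hw : IsAnalyticWeight w) {f g : ℝ → ℂ}
    (hf : Continuous f) (hg : Continuous g) :
    ‖angleInner w f g‖ ≤ (angleNormSq w f + angleNormSq w g) / 2 := by
  have hif := (continuous_angleNormSq_integrand hw hf).intervalIntegrable 0 (2 * Real.pi)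
    (μ := MeasureTheory.volume)
  have hig := (continuous_angleNormSq_integrand hw hg).intervalIntegrable 0 (2 * Real.pi)
    (μ := MeasureTheory.volume)
  rw [angleNormSq, angleNormSq, ← intervalIntegral.integral_add hif hig,
    ← intervalIntegral.integral_div]
  refine intervalIntegral.norm_integral_le_of_norm_le Real.two_pi_pos.le
    (Eventually.of_forall fun θ _ => ?_) ((hif.add hig).div_const 2)
  have h := hw.re_pos (circleMap 0 1 θ) (by simp)
  rw [← hw.coe_re θ, norm_mul, norm_mul, RCLike.norm_conj, Complex.norm_real, Real.norm_eq_abs,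
    abs_of_pos h, Complex.ofReal_re]
  nlinarith [mul_nonneg (sq_nonneg (‖f θ‖ - ‖g θ‖)) h.le]

theorem angleNormSq_le_of_bound {w : ℂ → ℂ} (hw : IsAnalyticWeight w) {f : ℝ → ℂ}
    (hf : Continuous f) {B : ℝ} (hB : ∀ θ, ‖f θ‖ ≤ B) :
    angleNormSq w f ≤ B ^ 2 * ∫ θ in (0 : ℝ)..2 * Real.pi, (w (circleMap 0 1 θ)).re := by
  rw [angleNormSq, ← intervalIntegral.integral_const_mul]
  refine intervalIntegral.integral_mono_on Real.two_pi_pos.le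
    ((continuous_angleNormSq_integrand hw hf).intervalIntegrable _ _)
    (((Complex.continuous_re.comp hw.continuous).const_mul _).intervalIntegrable _ _) ?_
  intro θ _
  have h := (hw.re_pos (circleMap 0 1 θ) (by simp)).le
  gcongr
  exact hB θ

/-! ### Reversed polynomials and orthogonality. -/

/-- The reversed polynomial `z^n conj(P(1 / conj z))`. -/
def conjReflect (n : ℕ) (P : ℂ[X]) : ℂ[X] :=
  (P.map (starRingEnd ℂ)).reflect n

theorem coeff_conjReflect (n : ℕ) (P : ℂ[X]) {k : ℕ} (hk : k ≤ n) :
    (conjReflect n P).coeff k = conj (P.coeff (n - k)) := by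
  rw [conjReflect, coeff_reflect, revAt_le hk, coeff_map]

theorem natDegree_conjReflect_le {n : ℕ} {P : ℂ[X]} (hP : P.natDegree ≤ n) :
    (conjReflect n P).natDegree ≤ n := by
  refine natDegree_le_iff_coeff_eq_zero.2 fun k hk => ?_
  rw [conjReflect, coeff_reflect, revAt_eq_self_of_lt hk, coeff_map,
    coeff_eq_zero_of_natDegree_lt (hP.trans_lt hk), map_zero]

theorem eval_conjReflect {n : ℕ} {P : ℂ[X]} (hP : P.natDegree ≤ n) {z : ℂ} (hz : ‖z‖ = 1) :
    (conjReflect n P).eval z = z ^ n * conj (P.eval z) := by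
  have hzz : conj z * z = 1 := by
    rw [Complex.conj_mul', hz]; simp
  let : Invertible (conj z) := ⟨z, by rw [mul_comm]; exact hzz, hzz⟩
  have h : (conjReflect n P).eval z * conj z ^ n = conj (P.eval z) := by
    have h := eval₂_reflect_mul_pow (RingHom.id ℂ) (conj z) n (P.map (starRingEnd ℂ))
      (by rwa [natDegree_map])
    rwa [eval₂_id, eval₂_id, eval_map_apply] at h
  rw [← h, mul_comm, mul_assoc, ← mul_pow, hzz, one_pow, mul_one]

theorem circleInner_eq_angleInner (w : ℂ → ℂ) (P Q : ℂ[X]) :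
    circleInner w P Q = angleInner w (onCircle fun z => P.eval z) (onCircle fun z => Q.eval z) :=
  rfl

theorem circleInner_add_right {w : ℂ → ℂ} (hw : IsAnalyticWeight w) (P Q Q' : ℂ[X]) :
    circleInner w P (Q + Q') = circleInner w P Q + circleInner w P Q' := by
  rw [← circleInner_conj hw, circleInner_add_left hw, map_add, circleInner_conj hw,
    circleInner_conj hw]

theorem circleInner_C_mul_right {w : ℂ → ℂ} (hw : IsAnalyticWeight w) (c : ℂ) (P Q : ℂ[X]) :
    circleInner w P (C c * Q) = conj c * circleInner w P Q := by
  rw [← circleInner_conj hw, circleInner_C_mul_left, map_mul, circleInner_conj hw]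

theorem IsOrthonormalPolynomials.leadingCoeff_ne_zero {w : ℂ → ℂ} {φ : ℕ → ℂ[X]}
    (hφ : IsOrthonormalPolynomials w φ) (n : ℕ) : (φ n).leadingCoeff ≠ 0 := fun h => by
  have := hφ.leadingCoeff_pos n
  rw [h] at this
  exact lt_irrefl _ this

theorem IsOrthonormalPolynomials.circleInner_eq_zero {w : ℂ → ℂ} {φ : ℕ → ℂ[X]}
    (hw : IsAnalyticWeight w) (hφ : IsOrthonormalPolynomials w φ) (n : ℕ) :
    ∀ d ≤ n, ∀ Q : ℂ[X], Q.degree < d → circleInner w (φ n) Q = 0 := by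
  intro d
  induction d with
  | zero =>
    intro _ Q hQ
    have : Q = 0 := by simpa using hQ
    simp [this, circleInner]
  | succ d ih =>
    intro hd Q hQ
    set c := Q.coeff d / (φ d).leadingCoeff
    have hlc : (φ d).coeff d = (φ d).leadingCoeff := by rw [leadingCoeff, hφ.natDegree_eq]
    have hS : (Q + C (-c) * φ d).degree < d := by
      rw [degree_lt_iff_coeff_zero]
      intro k hk
      rw [coeff_add, coeff_C_mul]
      rcases hk.eq_or_lt with rfl | hk
      · rw [hlc, neg_mul, div_mul_cancel₀ _ (hφ.leadingCoeff_ne_zero d)]; ring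
      · rw [(degree_lt_iff_coeff_zero Q (d + 1)).1 hQ k hk,
          coeff_eq_zero_of_natDegree_lt (by rw [hφ.natDegree_eq]; exact hk)]
        ring
    have h1 := ih (by omega) _ hS
    rw [circleInner_add_right hw, circleInner_C_mul_right hw, hφ.orthonormal,
      if_neg (by omega)] at h1
    simpa using h1

theorem natDegree_monicOP {w : ℂ → ℂ} {φ : ℕ → ℂ[X]} (hφ : IsOrthonormalPolynomials w φ) (n : ℕ) :
    (monicOP φ n).natDegree = n := by
  rw [monicOP, natDegree_C_mul (inv_ne_zero (hφ.leadingCoeff_ne_zero n)), hφ.natDegree_eq]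

theorem coeff_monicOP {w : ℂ → ℂ} {φ : ℕ → ℂ[X]} (hφ : IsOrthonormalPolynomials w φ) (n : ℕ) :
    (monicOP φ n).coeff n = 1 := by
  have hlc : (φ n).coeff n = (φ n).leadingCoeff := by rw [leadingCoeff, hφ.natDegree_eq]
  rw [monicOP, coeff_C_mul, hlc, inv_mul_cancel₀ (hφ.leadingCoeff_ne_zero n)]

theorem circleInner_monicOP {w : ℂ → ℂ} {φ : ℕ → ℂ[X]}
    (hw : IsAnalyticWeight w) (hφ : IsOrthonormalPolynomials w φ) {n : ℕ} {Q : ℂ[X]}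
    (hQ : Q.degree < n) : circleInner w (monicOP φ n) Q = 0 := by
  rw [monicOP, circleInner_C_mul_left, hφ.circleInner_eq_zero hw n n le_rfl Q hQ, mul_zero]

/-- The reversed orthogonal polynomial is orthogonal to the polynomials of degree at most `n` that
vanish at the origin. -/
theorem circleInner_conjReflect_monicOP {w : ℂ → ℂ} {φ : ℕ → ℂ[X]}
    (hw : IsAnalyticWeight w) (hφ : IsOrthonormalPolynomials w φ) {n : ℕ} {Q : ℂ[X]}
    (hQ : Q.natDegree ≤ n) (hQ0 : Q.coeff 0 = 0) :
    circleInner w (conjReflect n (monicOP φ n)) Q = 0 := by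
  -- On the circle, reversing both arguments exchanges them in the inner product; Q(0) = 0 removes
  -- the coefficient of degree n from the reversal of Q.
  have hdeg : (conjReflect n Q).degree < n := by
    rw [degree_lt_iff_coeff_zero]
    intro k hk
    rcases hk.eq_or_lt with rfl | hk
    · rw [coeff_conjReflect _ _ le_rfl, Nat.sub_self, hQ0, map_zero]
    · exact coeff_eq_zero_of_natDegree_lt ((natDegree_conjReflect_le hQ).trans_lt hk)
  have h : circleInner w (conjReflect n (monicOP φ n)) Q =
      circleInner w (conjReflect n Q) (monicOP φ n) := by
    rw [circleInner, circleInner]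
    congr 1; ext θ
    rw [eval_conjReflect (natDegree_monicOP hφ n).le (by simp), eval_conjReflect hQ (by simp)]
    ring
  rw [h, ← circleInner_conj hw, circleInner_monicOP hw hφ hdeg, map_zero]

/-! ### Polynomial approximation and the value of Φ_n at the origin. -/

/-- A function holomorphic in the disc of radius `R > 1` is approximated on the unit circle by
polynomials at every geometric rate larger than `1 / R`. -/
theorem exists_polynomial_approx {F : ℂ → ℂ} {R r : ℝ}
    (hF : DifferentiableOn ℂ F (Metric.ball 0 R)) (hr0 : 0 < r) (hr1 : r < 1) (hrR : 1 < r * R) :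
    ∃ T : ℕ → ℂ[X], ∃ B : ℝ, (∀ n, (T n).degree < n) ∧
      (∀ n, 1 ≤ n → (T n).coeff 0 = F 0) ∧
      ∀ n z, ‖z‖ = 1 → ‖F z - (T n).eval z‖ ≤ B * r ^ n := by
  have hR : 0 < R := by by_contra h; nlinarith
  -- The Taylor series is taken on a radius strictly between 1/r and R; comparison on the disc of
  -- radius 1/r then gives the rate |z| r = r on the unit circle.
  set R' : NNReal := ⟨(r⁻¹ + R) / 2, by positivity⟩ with hR'
  have hrinv : r⁻¹ < R := by rw [inv_lt_iff_one_lt_mul₀ hr0]; linarith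
  have hR'0 : 0 < R' := by
    rw [← NNReal.coe_pos]; show (0 : ℝ) < (r⁻¹ + R) / 2; positivity
  have hps : HasFPowerSeriesOnBall F (cauchyPowerSeries F 0 R') 0 R' :=
    (hF.mono (Metric.closedBall_subset_ball (by
      show (r⁻¹ + R) / 2 < R; linarith))).hasFPowerSeriesOnBall hR'0
  set p := cauchyPowerSeries F 0 R'
  set r' : NNReal := ⟨r⁻¹, by positivity⟩ with hr'
  have hlt : (r' : ENNReal) < R' := by
    rw [ENNReal.coe_lt_coe, ← NNReal.coe_lt_coe]
    show r⁻¹ < (r⁻¹ + R) / 2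
    linarith
  obtain ⟨a, ha, B, hB, happ⟩ := hps.uniform_geometric_approx' hlt
  refine ⟨fun n => ∑ k ∈ Finset.range n, C (p.coeff k) * X ^ k, B, fun n => ?_, fun n hn => ?_,
    fun n z hz => ?_⟩
  · rw [degree_lt_iff_coeff_zero]
    intro k hk
    rw [finsetSum_coeff]
    refine Finset.sum_eq_zero fun i hi => ?_
    rw [coeff_C_mul_X_pow, if_neg]
    have := Finset.mem_range.1 hi
    omega
  · rw [finsetSum_coeff, Finset.sum_eq_single_of_mem 0 (Finset.mem_range.2 hn)]
    · rw [coeff_C_mul_X_pow, if_pos rfl]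
      have := hps.coeff_zero (fun _ => 1)
      rw [← this]
      rfl
    · intro i _ hi
      rw [coeff_C_mul_X_pow, if_neg hi.symm]
  · have hzb : z ∈ Metric.ball (0 : ℂ) r' := by
      rw [mem_ball_zero_iff, hz]
      exact (one_lt_inv₀ hr0).2 hr1
    have h := happ z hzb n
    rw [zero_add] at h
    have he : p.partialSum n z = (∑ k ∈ Finset.range n, C (p.coeff k) * X ^ k).eval z := by
      rw [FormalMultilinearSeries.partialSum, eval_finsetSum]
      refine Finset.sum_congr rfl fun k _ => ?_
      rw [FormalMultilinearSeries.apply_eq_pow_smul_coeff]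
      rw [eval_mul, eval_C, eval_pow, eval_X, smul_eq_mul, mul_comm]
    rw [← he]
    refine h.trans ?_
    have h2 : ‖z‖ / (r' : ℝ) = r := by
      have h4 : (r' : ℝ) = r⁻¹ := rfl
      rw [hz, h4, one_div, inv_inv]
    rw [h2]
    have h3 : 0 < a := ha.1
    gcongr
    nlinarith [ha.2]

/-- The mean value property: pairing a polynomial against `F`, where `F conj(F) w = 1` on the
circle. -/
theorem angleInner_eval_eq {w : ℂ → ℂ} {F : ℂ → ℂ} {R : ℝ} (hR : 1 < R)
    (hF : DifferentiableOn ℂ F (Metric.ball 0 R)) (hF0 : ∀ z, ‖z‖ ≤ 1 → F z ≠ 0)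
    (hFw : ∀ z, ‖z‖ = 1 → F z * conj (F z) * w z = 1) (Q : ℂ[X]) :
    angleInner w (onCircle fun z => Q.eval z) (onCircle F) = 2 * Real.pi * (Q.coeff 0 / F 0) := by
  have hsub : Metric.closedBall (0 : ℂ) 1 ⊆ Metric.ball 0 R := Metric.closedBall_subset_ball hR
  -- Since conj(F) w = 1/F on the circle, the pairing is 2π times the mean of the holomorphic
  -- quotient Q/F.
  have hd : DiffContOnCl ℂ (fun z => Q.eval z / F z) (Metric.ball 0 |1|) := by
    rw [abs_one]
    refine DifferentiableOn.diffContOnCl ?_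
    rw [closure_ball _ one_ne_zero]
    exact Q.differentiable.differentiableOn.div (hF.mono hsub)
      fun z hz => hF0 z (by simpa using hz)
  have h := hd.circleAverage
  rw [Real.circleAverage_def, Complex.real_smul] at h
  have hpi : (Real.pi : ℂ) ≠ 0 := by exact_mod_cast Real.pi_ne_zero
  rw [coeff_zero_eq_eval_zero, ← h, angleInner]
  push_cast
  rw [← mul_assoc, mul_inv_cancel₀ (by simp), one_mul]
  congr 1; ext θ
  simp only [onCircle]
  have h1 := hFw (circleMap 0 1 θ) (by simp)
  rw [eq_div_iff (left_ne_zero_of_mul (left_ne_zero_of_mul (h1.trans_ne one_ne_zero)))]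
  linear_combination (Q.eval (circleMap 0 1 θ)) * h1


/-- Up to twice the geometric rate of polynomial approximation of `F`, the value `Φ_n(0)` is a
Fourier coefficient of the scattering function `conj(F) / F`. -/
theorem isBigO_monicOP_eval_zero {w : ℂ → ℂ} {φ : ℕ → ℂ[X]} (hw : IsAnalyticWeight w)
    (hφ : IsOrthonormalPolynomials w φ) {F : ℂ → ℂ} {R r : ℝ} (hR : 1 < R)
    (hF : DifferentiableOn ℂ F (Metric.ball 0 R)) (hF0 : ∀ z, ‖z‖ ≤ 1 → F z ≠ 0)
    (hFw : ∀ z, ‖z‖ = 1 → F z * conj (F z) * w z = 1) (hreal : conj (F 0) = F 0)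
    (hr0 : 0 < r) (hr1 : r < 1) (hrR : 1 < r * R) :
    (fun n => (monicOP φ n).eval 0 - 1 / (2 * Real.pi) * ∫ θ in (0 : ℝ)..2 * Real.pi,
      circleMap 0 1 θ ^ n * (conj (F (circleMap 0 1 θ)) / F (circleMap 0 1 θ)))
      =O[atTop] fun n => (r ^ 2) ^ n := by
  obtain ⟨T, B, hTdeg, hT0, hTB⟩ := exists_polynomial_approx hF hr0 hr1 hrR
  have hc : F 0 ≠ 0 := hF0 0 (by simp)
  set c := F 0
  have hFc : Continuous (onCircle F) := continuous_onCircle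
    (hF.continuousOn.mono (Metric.sphere_subset_ball hR))
  have hB0 : 0 ≤ B := by
    have := (norm_nonneg _).trans (hTB 0 1 (by simp))
    simpa using this
  set M := ∫ θ in (0 : ℝ)..2 * Real.pi, (w (circleMap 0 1 θ)).re with hM
  have hpi : (Real.pi : ℂ) ≠ 0 := by exact_mod_cast Real.pi_ne_zero
  refine IsBigO.of_bound (‖c‖ * (((B / ‖c‖) ^ 2 * M + B ^ 2 * M) / 2)) ?_
  filter_upwards [eventually_ge_atTop 1] with n hn
  set Φ := monicOP φ n with hΦ
  set P := conjReflect n Φ with hP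
  have hPdeg : P.natDegree ≤ n := natDegree_conjReflect_le (natDegree_monicOP hφ n).le
  have hP0 : P.coeff 0 = 1 := by
    rw [hP, coeff_conjReflect _ _ (Nat.zero_le n), Nat.sub_zero, coeff_monicOP hφ, map_one]
  have hTn : (T n).natDegree ≤ n := natDegree_le_of_degree_le (hTdeg n).le
  -- the error of the reversed polynomial and the error of the polynomial approximation
  set ε : ℝ → ℂ := fun θ => onCircle (fun z => P.eval z) θ - c⁻¹ * onCircle F θ with hε
  set g : ℝ → ℂ := fun θ => onCircle F θ - onCircle (fun z => (T n).eval z) θ with hg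
  have hPc := continuous_onCircle_eval P
  have hTc := continuous_onCircle_eval (T n)
  have hcFc : Continuous fun θ => c⁻¹ * onCircle F θ := hFc.const_mul _
  have hεc : Continuous ε := hPc.sub hcFc
  have hgc : Continuous g := hFc.sub hTc
  have horth : ∀ Q : ℂ[X], Q.natDegree ≤ n → Q.coeff 0 = 0 →
      angleInner w ε (onCircle fun z => Q.eval z) = 0 := by
    intro Q hQ hQ0
    rw [hε, angleInner_sub_left hw hPc hcFc (continuous_onCircle_eval Q),
      ← circleInner_eq_angleInner, circleInner_conjReflect_monicOP hw hφ hQ hQ0,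
      angleInner_const_mul_left, ← angleInner_conj hw, angleInner_eval_eq hR hF hF0 hFw, hQ0]
    simp
  have hnormg : angleNormSq w g ≤ (B * r ^ n) ^ 2 * M :=
    angleNormSq_le_of_bound hw hgc fun θ => hTB n _ (by simp)
  set g' : ℝ → ℂ := fun θ => c⁻¹ * g θ with hg'
  have hgc' : Continuous g' := hgc.const_mul _
  have hnormg' : angleNormSq w g' ≤ (B / ‖c‖ * r ^ n) ^ 2 * M :=
    angleNormSq_le_of_bound hw hgc' fun θ => by
      rw [hg', norm_mul, norm_inv, div_mul_eq_mul_div, inv_mul_eq_div]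
      gcongr
      exact hTB n _ (by simp)
  -- ε + g' is a polynomial of degree at most n vanishing at 0, hence orthogonal to ε. So ‖ε‖² =
  -- -⟨ε, g'⟩ ≤ (‖ε‖² + ‖g'‖²)/2, and the term in ε is absorbed.
  have hnormε : angleNormSq w ε ≤ angleNormSq w g' := by
    have h1 : ε = fun θ =>
        onCircle (fun z => (P - C c⁻¹ * T n).eval z) θ - g' θ := by
      ext θ
      simp only [hε, hg', hg, onCircle, eval_sub, eval_mul, eval_C]
      ring
    have h2 : angleInner w ε ε = - angleInner w ε g' := by
      refine (congrArg (angleInner w ε) h1).trans ?_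
      rw [angleInner_sub_right hw hεc (continuous_onCircle_eval _) hgc', horth _ ?_ ?_, zero_sub]
      · exact (natDegree_sub_le _ _).trans (max_le hPdeg ((natDegree_C_mul_le _ _).trans hTn))
      · rw [coeff_sub, coeff_C_mul, hP0, hT0 n hn, inv_mul_cancel₀ hc, sub_self]
    have h3 := norm_angleInner_le hw hεc hgc'
    rw [← norm_neg, ← h2, angleInner_self hw, Complex.norm_real, Real.norm_eq_abs,
      abs_of_nonneg (angleNormSq_nonneg hw ε)] at h3
    linarith
  -- the value at the origin
  set h : ℝ → ℂ := fun θ => circleMap 0 1 θ ^ n * conj (g θ) with hh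
  have hhc : Continuous h :=
    ((continuous_circleMap 0 1).pow n).mul (Complex.continuous_conj.comp hgc)
  have hFne : ∀ θ : ℝ, F (circleMap 0 1 θ) ≠ 0 := fun θ => hF0 _ (by simp)
  have hSc : Continuous fun θ : ℝ => circleMap 0 1 θ ^ n *
      (conj (F (circleMap 0 1 θ)) / F (circleMap 0 1 θ)) :=
    ((continuous_circleMap 0 1).pow n).mul ((Complex.continuous_conj.comp hFc).div hFc hFne)
  have hRc := continuous_onCircle_eval (conjReflect n (T n))
  -- This expands ⟨Φ, F⟩ by means of Φ = z^n conj(P), P = F/c + ε and F = T n + g on the circle,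
  -- with conj(F)² w = conj(F)/F.
  have hval : 2 * Real.pi * (Φ.eval 0 / c) = c⁻¹ * (∫ θ in (0 : ℝ)..2 * Real.pi,
      circleMap 0 1 θ ^ n * (conj (F (circleMap 0 1 θ)) / F (circleMap 0 1 θ))) +
      angleInner w (onCircle fun z => (conjReflect n (T n)).eval z) ε + angleInner w h ε := by
    have hsum : Continuous fun θ : ℝ => c⁻¹ * (circleMap 0 1 θ ^ n *
        (conj (F (circleMap 0 1 θ)) / F (circleMap 0 1 θ))) +
        onCircle (fun z => (conjReflect n (T n)).eval z) θ * conj (ε θ) * w (circleMap 0 1 θ) :=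
      (hSc.const_mul _).add (continuous_angleInner_integrand hw hRc hεc)
    rw [← coeff_zero_eq_eval_zero, ← angleInner_eval_eq hR hF hF0 hFw, angleInner, angleInner,
      angleInner, ← intervalIntegral.integral_const_mul, ← intervalIntegral.integral_add
      ((hSc.const_mul _).intervalIntegrable _ _)
      ((continuous_angleInner_integrand hw hRc hεc).intervalIntegrable _ _),
      ← intervalIntegral.integral_add (hsum.intervalIntegrable _ _)
      ((continuous_angleInner_integrand hw hhc hεc).intervalIntegrable _ _)]
    congr 1; ext θ
    have he : ‖circleMap 0 1 θ‖ = 1 := by simp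
    have hee : circleMap 0 1 θ ^ n * conj (circleMap 0 1 θ) ^ n = 1 := by
      rw [← mul_pow, Complex.mul_conj', he]; simp
    have h1 := hFw _ he
    have h2 := hFne θ
    have h3 : conj (F (circleMap 0 1 θ)) / F (circleMap 0 1 θ) =
        conj (F (circleMap 0 1 θ)) ^ 2 * w (circleMap 0 1 θ) := by
      rw [div_eq_iff h2]
      linear_combination -conj (F (circleMap 0 1 θ)) * h1
    have h4 : P.eval (circleMap 0 1 θ) = circleMap 0 1 θ ^ n * conj (Φ.eval (circleMap 0 1 θ)) :=
      eval_conjReflect (natDegree_monicOP hφ n).le he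
    simp only [hh, hε, hg, onCircle, h4, eval_conjReflect hTn he, map_sub, map_mul, map_inv₀, hreal, map_pow,
      Complex.conj_conj, h3]
    linear_combination (-conj (F (circleMap 0 1 θ)) * w (circleMap 0 1 θ) *
      Φ.eval (circleMap 0 1 θ)) * hee
  -- T n has degree strictly less than n, so its reversal vanishes at 0 and is orthogonal to ε. What
  -- is left, ⟨h, ε⟩, pairs two errors of order r^n.
  have hz : angleInner w (onCircle fun z => (conjReflect n (T n)).eval z) ε = 0 := by
    rw [← angleInner_conj hw, horth _ (natDegree_conjReflect_le hTn), map_zero]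
    rw [coeff_conjReflect _ _ (Nat.zero_le n), Nat.sub_zero,
      (degree_lt_iff_coeff_zero (T n) n).1 (hTdeg n) n le_rfl, map_zero]
  have hdiff : Φ.eval 0 - 1 / (2 * Real.pi) * (∫ θ in (0 : ℝ)..2 * Real.pi,
      circleMap 0 1 θ ^ n * (conj (F (circleMap 0 1 θ)) / F (circleMap 0 1 θ))) =
      c * angleInner w h ε / (2 * Real.pi) := by
    rw [hz, add_zero] at hval
    field_simp at hval ⊢
    linear_combination hval
  have hnormh : angleNormSq w h = angleNormSq w g := by
    simp [angleNormSq, hh]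
  have hpi1 : 1 ≤ 2 * Real.pi := by linarith [Real.pi_gt_three]
  rw [hdiff, norm_div, norm_mul]
  have hn2 : ‖(2 * Real.pi : ℂ)‖ = 2 * Real.pi := by
    rw [norm_mul, Complex.norm_real, Real.norm_eq_abs, abs_of_pos Real.pi_pos]; simp
  rw [hn2]
  refine (div_le_self (by positivity) hpi1).trans ?_
  rw [Real.norm_of_nonneg (by positivity : (0 : ℝ) ≤ (r ^ 2) ^ n), mul_assoc]
  gcongr
  refine (norm_angleInner_le hw hhc hεc).trans ?_
  rw [hnormh]
  have : (r ^ 2) ^ n = (r ^ n) ^ 2 := by rw [← pow_mul, ← pow_mul, mul_comm]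
  rw [this]
  nlinarith

/-! ### Continuation of 1/D_i and the scattering function. -/

/-- The reciprocal of the interior Szegő function, continued across the unit circle by means of a
continuation of the exterior one. -/
def interiorReciprocal (w De : ℂ → ℂ) (z : ℂ) : ℂ :=
  -- The origin reflects to infinity, whereas `0⁻¹ = 0`, so its value is given separately.
  if z = 0 then (szegoFunction w 0)⁻¹ else conj (De (conj z)⁻¹)

theorem interiorReciprocal_eq {w De : ℂ → ℂ} {ρ ρ' : ℝ}
    (hDe : IsMeromorphicContinuation w ρ ρ' De) {z : ℂ} (hz : ‖z‖ < 1) :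
    interiorReciprocal w De z = (szegoFunction w z)⁻¹ := by
  rw [interiorReciprocal]
  split_ifs with h
  · rw [h]
  · rw [hDe.eq_szego, szegoFunction_conj_inv w h hz.ne, map_inv₀, Complex.conj_conj]
    rw [norm_inv, RCLike.norm_conj]
    exact (one_lt_inv₀ (norm_pos_iff.2 h)).2 hz

theorem differentiableOn_interiorReciprocal {w De : ℂ → ℂ} {ρ ρ' : ℝ} (hw : IsAnalyticWeight w)
    (hDe : IsMeromorphicContinuation w ρ ρ' De) (hρ' : ρ' < ρ) (hρ : 0 < ρ) :
    DifferentiableOn ℂ (interiorReciprocal w De) (Metric.ball 0 ρ⁻¹) := by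
  intro z hz
  refine DifferentiableAt.differentiableWithinAt ?_
  rcases lt_or_ge ‖z‖ 1 with h | h
  · have hzb : Metric.ball (0 : ℂ) 1 ∈ 𝓝 z := Metric.isOpen_ball.mem_nhds (by simpa using h)
    refine DifferentiableAt.congr_of_eventuallyEq (f := fun y => (szegoFunction w y)⁻¹) ?_ ?_
    · exact ((szegoFunction_differentiableOn hw).differentiableAt hzb).inv
        (szegoFunction_ne_zero w z)
    · filter_upwards [hzb] with y hy
      exact interiorReciprocal_eq hDe (by simpa using hy)
  · have hz0 : z ≠ 0 := fun h0 => by rw [h0, norm_zero] at h; linarith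
    refine DifferentiableAt.congr_of_eventuallyEq
      (f := conj ∘ (fun y => De y⁻¹) ∘ conj) ?_ ?_
    · have hc0 : conj z ≠ 0 := by simpa using hz0
      have hlt : ρ < ‖(conj z)⁻¹‖ := by
        rw [norm_inv, RCLike.norm_conj, lt_inv_comm₀ hρ (norm_pos_iff.2 hz0)]
        simpa using hz
      have hd : DifferentiableAt ℂ (fun y => De y⁻¹) (conj z) :=
        DifferentiableAt.comp (conj z)
          (hDe.analytic _ (hρ'.trans hlt) hlt.ne').differentiableAt (differentiableAt_inv hc0)
      simpa using hd.conj_conj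
    · filter_upwards [isOpen_ne.mem_nhds hz0] with y hy
      simp [interiorReciprocal, if_neg hy]

theorem interiorReciprocal_of_norm_eq_one (w De : ℂ → ℂ) {z : ℂ} (hz : ‖z‖ = 1) :
    interiorReciprocal w De z = conj (De z) := by
  have hz0 : z ≠ 0 := fun h0 => by rw [h0, norm_zero] at hz; exact zero_ne_one hz
  have hzz : (conj z)⁻¹ = z :=
    inv_eq_of_mul_eq_one_right <| by rw [Complex.conj_mul', hz]; simp
  rw [interiorReciprocal, if_neg hz0, hzz]

/-- The continuation is continuous across the circle, so its modulus there is the radial limit from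
inside, which the Poisson integral identifies. -/
theorem interiorReciprocal_mul_conj {w De : ℂ → ℂ} {ρ ρ' : ℝ} (hw : IsAnalyticWeight w)
    (hDe : IsMeromorphicContinuation w ρ ρ' De) (hρ' : ρ' < ρ) (hρ : 0 < ρ) (hρ1 : ρ < 1)
    {z : ℂ} (hz : ‖z‖ = 1) :
    interiorReciprocal w De z * conj (interiorReciprocal w De z) * w z = 1 := by
  have hpos := hw.re_pos z hz
  have hmem : z ∈ Metric.ball (0 : ℂ) ρ⁻¹ := by
    rw [mem_ball_zero_iff, hz]; exact (one_lt_inv₀ hρ).2 hρ1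
  have hcont : ContinuousAt (interiorReciprocal w De) (((1 : ℝ) : ℂ) * z) := by
    rw [Complex.ofReal_one, one_mul]
    exact ((differentiableOn_interiorReciprocal hw hDe hρ' hρ).differentiableAt
      (Metric.isOpen_ball.mem_nhds hmem)).continuousAt
  have hlim : Tendsto (fun r : ℝ => ‖interiorReciprocal w De (r * z)‖ ^ 2) (𝓝[<] 1)
      (𝓝 (‖interiorReciprocal w De z‖ ^ 2)) := by
    have h1 : ContinuousAt (fun r : ℝ => ‖interiorReciprocal w De (r * z)‖ ^ 2) 1 :=
      (ContinuousAt.comp (f := fun r : ℝ => (r : ℂ) * z) hcont (by fun_prop)).norm.pow 2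
    have h2 := h1.tendsto
    rw [Complex.ofReal_one, one_mul] at h2
    exact h2.mono_left nhdsWithin_le_nhds
  have hlim' := (tendsto_norm_szegoFunction_sq hw hz).inv₀ hpos.ne'
  have heq : ‖interiorReciprocal w De z‖ ^ 2 = (w z).re⁻¹ := by
    refine tendsto_nhds_unique hlim (hlim'.congr' ?_)
    filter_upwards [Ioo_mem_nhdsLT (zero_lt_one' ℝ)] with r hr
    rw [interiorReciprocal_eq hDe (by simp [hz, abs_of_pos hr.1, hr.2]), norm_inv, inv_pow]
  have hwre : w z = ((w z).re : ℂ) := Complex.ext rfl (by simpa using hw.im_eq_zero z hz)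
  rw [Complex.mul_conj', ← Complex.ofReal_pow, heq, hwre, Complex.ofReal_re, ← Complex.ofReal_mul,
    inv_mul_cancel₀ hpos.ne', Complex.ofReal_one]

theorem interiorReciprocal_ne_zero {w De : ℂ → ℂ} {ρ ρ' : ℝ} (hw : IsAnalyticWeight w)
    (hDe : IsMeromorphicContinuation w ρ ρ' De) (hρ' : ρ' < ρ) (hρ : 0 < ρ) (hρ1 : ρ < 1)
    {z : ℂ} (hz : ‖z‖ ≤ 1) : interiorReciprocal w De z ≠ 0 := by
  rcases hz.lt_or_eq with h | h
  · rw [interiorReciprocal_eq hDe h]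
    exact inv_ne_zero (szegoFunction_ne_zero w z)
  · exact left_ne_zero_of_mul (left_ne_zero_of_mul
      ((interiorReciprocal_mul_conj hw hDe hρ' hρ hρ1 h).trans_ne one_ne_zero))

theorem conj_interiorReciprocal_zero (w De : ℂ → ℂ) :
    conj (interiorReciprocal w De 0) = interiorReciprocal w De 0 := by
  obtain ⟨c, -, hc⟩ := szegoFunction_zero_pos w
  rw [interiorReciprocal, if_pos rfl, hc, map_inv₀, Complex.conj_ofReal]

theorem diffContOnCl_inv_interiorReciprocal {w De : ℂ → ℂ} {ρ ρ' : ℝ} (hw : IsAnalyticWeight w)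
    (hDe : IsMeromorphicContinuation w ρ ρ' De) (hρ' : ρ' < ρ) (hρ : 0 < ρ) (hρ1 : ρ < 1) :
    DiffContOnCl ℂ (fun z => (interiorReciprocal w De z)⁻¹) (Metric.ball 0 1) := by
  refine DifferentiableOn.diffContOnCl ?_
  rw [closure_ball _ one_ne_zero]
  exact ((differentiableOn_interiorReciprocal hw hDe hρ' hρ).mono
    (Metric.closedBall_subset_ball ((one_lt_inv₀ hρ).2 hρ1))).inv
    fun z hz => interiorReciprocal_ne_zero hw hDe hρ' hρ hρ1 (by simpa using hz)

/-- Up to a geometrically smaller error, the Verblunsky coefficients are Laurent coefficients of the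
scattering function. -/
theorem isBigO_verblunsky_sub {w De : ℂ → ℂ} {φ : ℕ → ℂ[X]} {ρ ρ' r : ℝ}
    (hw : IsAnalyticWeight w) (hφ : IsOrthonormalPolynomials w φ)
    (hDe : IsMeromorphicContinuation w ρ ρ' De) (hρ' : ρ' < ρ) (hρ : 0 < ρ) (hr : ρ < r)
    (hr1 : r < 1) :
    (fun n => verblunsky φ n - -conj ((2 * Real.pi * Complex.I)⁻¹ *
      ∮ z in C(0, 1), z ^ n * (interiorReciprocal w De z)⁻¹ * De z)) =O[atTop]
      fun n => (r ^ 2) ^ n := by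
  have hr0 := hρ.trans hr
  have hρ1 := hr.trans hr1
  have h := isBigO_monicOP_eval_zero hw hφ ((one_lt_inv₀ hρ).2 hρ1)
    (differentiableOn_interiorReciprocal hw hDe hρ' hρ)
    (fun z => interiorReciprocal_ne_zero hw hDe hρ' hρ hρ1)
    (fun z => interiorReciprocal_mul_conj hw hDe hρ' hρ hρ1)
    (conj_interiorReciprocal_zero w De) hr0 hr1
    (by rw [← div_eq_mul_inv]; exact (one_lt_div hρ).2 hr)
  have h1 := (h.comp_tendsto (tendsto_add_atTop_nat 1))
  have h2 : ((fun n : ℕ => (r ^ 2) ^ n) ∘ fun a => a + 1) =O[atTop] fun n => (r ^ 2) ^ n := by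
    refine IsBigO.of_bound (r ^ 2) (Eventually.of_forall fun n => ?_)
    rw [Function.comp, pow_succ, norm_mul, mul_comm, Real.norm_of_nonneg (sq_nonneg r)]
  refine ((h1.trans h2).norm_left.congr_left fun n => ?_).of_norm_left
  -- The factor dz = iz dθ accounts for the passage from z^n to z^(n+1), matching the shift of index
  -- in α_n.
  have hint : (2 * Real.pi * Complex.I)⁻¹ *
      (∮ z in C(0, 1), z ^ n * (interiorReciprocal w De z)⁻¹ * De z) =
      1 / (2 * Real.pi) * ∫ θ in (0 : ℝ)..2 * Real.pi, circleMap 0 1 θ ^ (n + 1) *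
        (conj (interiorReciprocal w De (circleMap 0 1 θ)) /
          interiorReciprocal w De (circleMap 0 1 θ)) := by
    have h3 : (∮ z in C(0, 1), z ^ n * (interiorReciprocal w De z)⁻¹ * De z) =
        Complex.I * ∫ θ in (0 : ℝ)..2 * Real.pi, circleMap 0 1 θ ^ (n + 1) *
        (conj (interiorReciprocal w De (circleMap 0 1 θ)) /
          interiorReciprocal w De (circleMap 0 1 θ)) := by
      rw [circleIntegral, ← intervalIntegral.integral_const_mul]
      refine intervalIntegral.integral_congr fun θ _ => ?_
      have he : conj (interiorReciprocal w De (circleMap 0 1 θ)) = De (circleMap 0 1 θ) := by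
        rw [interiorReciprocal_of_norm_eq_one w De (by simp), Complex.conj_conj]
      simp only [he, deriv_circleMap, smul_eq_mul]
      ring
    rw [h3]
    have hpi : (Real.pi : ℂ) ≠ 0 := by exact_mod_cast Real.pi_ne_zero
    have hI := Complex.I_ne_zero
    field_simp
  rw [hint, verblunsky, sub_neg_eq_add, neg_add_eq_sub, ← map_sub, RCLike.norm_conj, norm_sub_rev]
  rfl

/-! ### Moments of the polar terms. -/

/-- The Laurent coefficients `(1 / 2πi) ∮ z^n H(z) (z - a)^{-j} dz` over the unit circle. -/
def polarMoment (H : ℂ → ℂ) (a : ℂ) (n j : ℕ) : ℂ :=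
  (2 * Real.pi * Complex.I)⁻¹ * ∮ z in C(0, 1), z ^ n * H z * ((z - a) ^ j)⁻¹

theorem two_pi_I_ne_zero : (2 * Real.pi * Complex.I : ℂ) ≠ 0 := by
  simp

theorem _root_.DiffContOnCl.continuousOn_sphere {H : ℂ → ℂ}
    (hH : DiffContOnCl ℂ H (Metric.ball 0 1)) : ContinuousOn H (Metric.sphere 0 1) :=
  hH.continuousOn_ball.mono Metric.sphere_subset_closedBall

theorem diffContOnCl_dslope {H : ℂ → ℂ} (hH : DiffContOnCl ℂ H (Metric.ball 0 1)) {a : ℂ}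
    (ha : ‖a‖ < 1) : DiffContOnCl ℂ (dslope H a) (Metric.ball 0 1) := by
  have hmem : Metric.ball (0 : ℂ) 1 ∈ 𝓝 a := Metric.isOpen_ball.mem_nhds (by simpa using ha)
  refine ⟨(Complex.differentiableOn_dslope hmem).2 hH.1, ?_⟩
  rw [closure_ball _ one_ne_zero,
    continuousOn_dslope (mem_of_superset hmem Metric.ball_subset_closedBall)]
  exact ⟨hH.continuousOn_ball, hH.1.differentiableAt hmem⟩

theorem sub_ne_zero_of_norm {a z : ℂ} (ha : ‖a‖ < 1) (hz : z ∈ Metric.sphere (0 : ℂ) 1) :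
    z - a ≠ 0 := fun h => by
  rw [mem_sphere_zero_iff_norm, sub_eq_zero.1 h] at hz
  exact ha.ne hz

theorem continuousOn_polarMoment_integrand {H : ℂ → ℂ}
    (hH : ContinuousOn H (Metric.sphere 0 1)) {a : ℂ} (ha : ‖a‖ < 1) (n j : ℕ) :
    ContinuousOn (fun z => z ^ n * H z * ((z - a) ^ j)⁻¹) (Metric.sphere 0 1) :=
  ((continuousOn_id.pow n).mul hH).mul (((continuousOn_id.sub continuousOn_const).pow j).inv₀
    fun _ hz => pow_ne_zero _ (sub_ne_zero_of_norm ha hz))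

theorem circleIntegrable_polarMoment_integrand {H : ℂ → ℂ}
    (hH : ContinuousOn H (Metric.sphere 0 1)) {a : ℂ} (ha : ‖a‖ < 1) (n j : ℕ) :
    CircleIntegrable (fun z => z ^ n * H z * ((z - a) ^ j)⁻¹) 0 1 :=
  (continuousOn_polarMoment_integrand hH ha n j).circleIntegrable zero_le_one

theorem polarMoment_zero_right {H : ℂ → ℂ} (hH : DiffContOnCl ℂ H (Metric.ball 0 1)) (a : ℂ)
    (n : ℕ) : polarMoment H a n 0 = 0 := by
  rw [polarMoment, Complex.circleIntegral_eq_zero_of_differentiable_on_off_countable zero_le_one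
    Set.countable_empty, mul_zero]
  · simp only [pow_zero, inv_one, mul_one]
    exact (continuousOn_id.pow n).mul hH.continuousOn_ball
  · intro z hz
    have := hH.differentiableAt Metric.isOpen_ball hz.1
    simp only [pow_zero, inv_one, mul_one]
    fun_prop

/-- Writing H = H(a) + (z - a) `dslope H a` separates an explicit term from a moment with pole order
lower by one; this drives the inductions on the order. -/
theorem polarMoment_succ {H : ℂ → ℂ} (hH : DiffContOnCl ℂ H (Metric.ball 0 1)) {a : ℂ}
    (ha : ‖a‖ < 1) (n j : ℕ) :
    polarMoment H a n (j + 1) =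
      H a * polarMoment (fun _ => 1) a n (j + 1) + polarMoment (dslope H a) a n j := by
  have h1 : CircleIntegrable (fun z => H a * (z ^ n * 1 * ((z - a) ^ (j + 1))⁻¹)) 0 1 :=
    (continuousOn_const.mul (continuousOn_polarMoment_integrand continuousOn_const ha n
      (j + 1))).circleIntegrable zero_le_one
  rw [polarMoment, polarMoment, polarMoment, mul_left_comm, ← mul_add,
    ← circleIntegral.integral_const_mul (H a), ← circleIntegral.integral_add h1
    (circleIntegrable_polarMoment_integrand (diffContOnCl_dslope hH ha).continuousOn_sphere ha n j)]
  congr 1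
  refine circleIntegral.integral_congr zero_le_one fun z hz => ?_
  have hne := sub_ne_zero_of_norm ha hz
  have h2 := sub_smul_dslope H a z
  rw [smul_eq_mul] at h2
  have h3 : H z = H a + (z - a) * dslope H a z := by rw [h2]; ring
  simp only [h3]
  field_simp
  ring

theorem polarMoment_one_step {a : ℂ} (ha : ‖a‖ < 1) (n j : ℕ) :
    polarMoment (fun _ => 1) a (n + 1) (j + 1) =
      polarMoment (fun _ => 1) a n j + a * polarMoment (fun _ => 1) a n (j + 1) := by
  have h1 : CircleIntegrable (fun z => a * (z ^ n * 1 * ((z - a) ^ (j + 1))⁻¹)) 0 1 :=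
    (continuousOn_const.mul (continuousOn_polarMoment_integrand continuousOn_const ha n
      (j + 1))).circleIntegrable zero_le_one
  rw [polarMoment, polarMoment, polarMoment, mul_left_comm, ← mul_add,
    ← circleIntegral.integral_const_mul a, ← circleIntegral.integral_add
    (circleIntegrable_polarMoment_integrand continuousOn_const ha n j) h1]
  congr 1
  refine circleIntegral.integral_congr zero_le_one fun z hz => ?_
  have hne := sub_ne_zero_of_norm ha hz
  field_simp
  ring

/-- The recursion z = (z - a) + a is Pascal's rule. For j > n the binomial vanishes, so the
truncated exponent does no harm. -/
theorem polarMoment_one {a : ℂ} (ha : ‖a‖ < 1) (n : ℕ) :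
    ∀ j, polarMoment (fun _ => 1) a n (j + 1) = n.choose j * a ^ (n - j) := by
  induction n with
  | zero =>
    rintro (_ | j)
    · have : (∮ z in C(0, 1), (z - a)⁻¹) = 2 * Real.pi * Complex.I :=
        circleIntegral.integral_sub_inv_of_mem_ball (by simpa using ha)
      simp only [polarMoment, pow_zero, zero_add, pow_one, one_mul, this, Nat.choose_self]
      rw [inv_mul_cancel₀ two_pi_I_ne_zero]
      simp
    · have h := circleIntegral.integral_sub_zpow_of_ne (n := -((j + 1 + 1 : ℕ) : ℤ))
        (by omega) 0 a 1
      simp only [zpow_neg, zpow_natCast] at h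
      simp [polarMoment, h]
  | succ n ih =>
    rintro (_ | j)
    · rw [polarMoment_one_step ha, ih, polarMoment_zero_right diffContOnCl_const]
      simp [pow_succ']
    · rw [polarMoment_one_step ha, ih, ih, Nat.choose_succ_succ, Nat.succ_sub_succ]
      rcases lt_or_ge n (j + 1) with h | h
      · rw [Nat.choose_eq_zero_of_lt h]; simp
      · obtain ⟨k, rfl⟩ := Nat.exists_eq_add_of_le h
        rw [show j + 1 + k - j = k + 1 by omega, show j + 1 + k - (j + 1) = k by omega]
        push_cast
        ring

theorem isBigO_choose_mul_pow {a : ℂ} (ha0 : a ≠ 0) (i j : ℕ) :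
    (fun n : ℕ => ((n + i).choose j : ℂ) * a ^ (n - j)) =O[atTop]
      fun n : ℕ => (n : ℝ) ^ j * ‖a‖ ^ n := by
  refine IsBigO.of_bound ((i + 1 : ℝ) ^ j * (‖a‖ ^ j)⁻¹) ?_
  filter_upwards [eventually_ge_atTop j, eventually_ge_atTop 1] with n hn hn1
  have hpos : 0 < ‖a‖ := norm_pos_iff.2 ha0
  have h1 : (((n + i).choose j : ℕ) : ℝ) ≤ ((n : ℝ) * (i + 1)) ^ j := by
    have h2 : (n + i).choose j ≤ (n * (i + 1)) ^ j :=
      (Nat.choose_le_pow _ _).trans (Nat.pow_le_pow_left (by nlinarith) _)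
    exact_mod_cast h2
  rw [norm_mul, norm_pow, Complex.norm_natCast, norm_mul, norm_pow, norm_pow, norm_norm,
    Real.norm_natCast]
  have h3 : ‖a‖ ^ n = ‖a‖ ^ (n - j) * ‖a‖ ^ j := by rw [← pow_add, Nat.sub_add_cancel hn]
  rw [h3]
  calc (((n + i).choose j : ℕ) : ℝ) * ‖a‖ ^ (n - j)
      ≤ ((n : ℝ) * (i + 1)) ^ j * ‖a‖ ^ (n - j) := by gcongr
    _ = _ := by rw [mul_pow]; field_simp

theorem isBigO_pow_mul_of_le {i j : ℕ} (h : i ≤ j) (x : ℝ) :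
    (fun n : ℕ => (n : ℝ) ^ i * x ^ n) =O[atTop] fun n : ℕ => (n : ℝ) ^ j * x ^ n := by
  refine IsBigO.mul (IsBigO.of_bound 1 ?_) (isBigO_refl _ _)
  filter_upwards [eventually_ge_atTop 1] with n hn
  rw [norm_pow, norm_pow, Real.norm_natCast, one_mul]
  exact pow_le_pow_right₀ (by exact_mod_cast hn) h

theorem isBigO_polarMoment {a : ℂ} (ha0 : a ≠ 0) (ha : ‖a‖ < 1) (j : ℕ) :
    ∀ {H : ℂ → ℂ}, DiffContOnCl ℂ H (Metric.ball 0 1) →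
    (fun n => polarMoment H a n (j + 1)) =O[atTop] fun n : ℕ => (n : ℝ) ^ j * ‖a‖ ^ n := by
  have hmain : ∀ (j : ℕ) (H : ℂ → ℂ), (fun n => H a * polarMoment (fun _ => 1) a n (j + 1))
      =O[atTop] fun n : ℕ => (n : ℝ) ^ j * ‖a‖ ^ n := fun j H => by
    simp only [polarMoment_one ha]
    exact (isBigO_choose_mul_pow ha0 0 j).const_mul_left _
  induction j with
  | zero =>
    intro H hH
    simp only [polarMoment_succ hH ha, polarMoment_zero_right (diffContOnCl_dslope hH ha),
      add_zero]
    exact hmain 0 H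
  | succ j ih =>
    intro H hH
    simp only [polarMoment_succ hH ha _ (j + 1)]
    exact (hmain _ H).add ((ih (diffContOnCl_dslope hH ha)).trans
      (isBigO_pow_mul_of_le (Nat.le_succ j) _))

/-! ### Poles and principal parts. -/

theorem exists_principalPart {a : ℂ} (m : ℕ) :
    ∀ {g : ℂ → ℂ} {f : ℂ → ℂ}, AnalyticAt ℂ g a → (∀ᶠ z in 𝓝[≠] a, f z = g z * ((z - a) ^ m)⁻¹) →
    ∃ (c : ℕ → ℂ) (h : ℂ → ℂ), AnalyticAt ℂ h a ∧ (1 ≤ m → c (m - 1) = g a) ∧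
      ∀ᶠ z in 𝓝[≠] a, f z = h z + ∑ j ∈ Finset.range m, c j * ((z - a) ^ (j + 1))⁻¹ := by
  induction m with
  | zero =>
    intro g f hg hfg
    exact ⟨0, g, hg, by simp, by simpa using hfg⟩
  | succ m ih =>
    intro g f hg hfg
    have hg1 : AnalyticAt ℂ (dslope g a) a := by
      obtain ⟨p, hp⟩ := hg
      exact hp.has_fpower_series_dslope_fslope.analyticAt
    obtain ⟨c, h, hh, -, hc⟩ := ih (f := fun z => dslope g a z * ((z - a) ^ m)⁻¹) hg1
      (Eventually.of_forall fun _ => rfl)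
    refine ⟨Function.update c m (g a), h, hh, fun _ => by simp, ?_⟩
    filter_upwards [hfg, hc, self_mem_nhdsWithin] with z hz hcz hza
    have hne : z - a ≠ 0 := sub_ne_zero.2 hza
    have hsum : ∑ j ∈ Finset.range m, Function.update c m (g a) j * ((z - a) ^ (j + 1))⁻¹ =
        ∑ j ∈ Finset.range m, c j * ((z - a) ^ (j + 1))⁻¹ :=
      Finset.sum_congr rfl fun j hj => by
        rw [Function.update_of_ne (Finset.mem_range.1 hj).ne]
    have h3 : g z = g a + (z - a) * dslope g a z := by
      have := sub_smul_dslope g a z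
      rw [smul_eq_mul] at this
      rw [this]; ring
    rw [Finset.sum_range_succ, hsum, ← add_assoc, ← hcz, Function.update_self, hz, h3]
    field_simp
    ring

/-- The exponent may exceed the multiplicity, so one m serves for all poles. -/
theorem exists_analyticAt_mul_pow {f : ℂ → ℂ} {a : ℂ} (hf : MeromorphicAt f a) {m : ℕ}
    (hm : -(m : ℤ) ≤ meromorphicOrderAt f a) :
    ∃ g : ℂ → ℂ, AnalyticAt ℂ g a ∧ ∀ᶠ z in 𝓝[≠] a, f z = g z * ((z - a) ^ m)⁻¹ := by
  have hp : MeromorphicAt (fun z => (z - a) ^ m) a :=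
    AnalyticAt.meromorphicAt (by fun_prop)
  have hord : 0 ≤ meromorphicOrderAt (f * fun z => (z - a) ^ m) a := by
    rw [meromorphicOrderAt_mul hf hp, fun_meromorphicOrderAt_pow_id_sub_const]
    cases h : meromorphicOrderAt f a with
    | top => simp
    | coe k =>
      rw [h] at hm
      norm_cast at hm ⊢
      omega
  obtain ⟨g, hg, hfg⟩ := ((hf.mul hp).meromorphicOrderAt_nonneg_iff).1 hord
  refine ⟨g, hg, ?_⟩
  filter_upwards [hfg, self_mem_nhdsWithin] with z hz hza
  have hne : z - a ≠ 0 := sub_ne_zero.2 hza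
  rw [← hz]
  simp only [Pi.mul_apply]
  field_simp

theorem neg_poleMultiplicity_le {f : ℂ → ℂ} {a : ℂ} :
    -(poleMultiplicity f a : ℤ) ≤ meromorphicOrderAt f a := by
  cases h : meromorphicOrderAt f a with
  | top => simp
  | coe k =>
    rw [poleMultiplicity, h]
    norm_cast
    simp only [WithTop.untop₀_coe]
    omega

theorem one_le_poleMultiplicity {f : ℂ → ℂ} {a : ℂ} (h : IsPole f a) :
    1 ≤ poleMultiplicity f a := by
  obtain ⟨-, hlt⟩ := h
  obtain ⟨k, hk⟩ := WithTop.ne_top_iff_exists.1 hlt.ne_top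
  rw [← hk] at hlt
  have hk0 : k < 0 := by exact_mod_cast hlt
  rw [poleMultiplicity, ← hk, WithTop.untop₀_coe]
  omega

theorem polarCoeff_eq {f g : ℂ → ℂ} {a : ℂ} {m : ℕ} (hg : AnalyticAt ℂ g a)
    (hfg : ∀ᶠ z in 𝓝[≠] a, f z = g z * ((z - a) ^ m)⁻¹) : polarCoeff f m a = g a := by
  refine Tendsto.limUnder_eq ((hg.continuousAt.tendsto.mono_left nhdsWithin_le_nhds).congr' ?_)
  filter_upwards [hfg, self_mem_nhdsWithin] with z hz hza
  have hne : z - a ≠ 0 := sub_ne_zero.2 hza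
  rw [hz]
  field_simp

/-- This allows a sum over the dominant poles to be extended to all poles. -/
theorem polarCoeff_eq_zero {f : ℂ → ℂ} {a : ℂ} (h : IsPole f a) {m : ℕ}
    (hm : poleMultiplicity f a < m) : polarCoeff f m a = 0 := by
  obtain ⟨k, rfl⟩ := Nat.exists_eq_add_of_lt hm
  refine Tendsto.limUnder_eq ?_
  have h1 := tendsto_polarCoeff h
  have h2 : Tendsto (fun z : ℂ => (z - a) ^ (k + 1)) (𝓝[≠] a) (𝓝 0) := by
    have : Tendsto (fun z : ℂ => (z - a) ^ (k + 1)) (𝓝 a) (𝓝 ((a - a) ^ (k + 1))) :=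
      Continuous.tendsto (by fun_prop) a
    rw [sub_self, zero_pow (Nat.succ_ne_zero k)] at this
    exact this.mono_left nhdsWithin_le_nhds
  have h3 := h1.mul h2
  rw [mul_zero] at h3
  refine h3.congr fun z => ?_
  rw [add_assoc, pow_add _ _ (k + 1), mul_assoc]

theorem isPole_of_isSingularity {f : ℂ → ℂ} {b : ℂ} (hf : MeromorphicAt f b)
    (h : IsSingularity f b) : IsPole f b := by
  refine ⟨hf, ?_⟩
  by_contra hlt
  exact h ((hf.meromorphicOrderAt_nonneg_iff).1 (not_lt.1 hlt))

theorem IsPole.isSingularity {f : ℂ → ℂ} {b : ℂ} (h : IsPole f b) : IsSingularity f b :=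
  fun ⟨_, hg⟩ => h.2.not_ge ((h.1.meromorphicOrderAt_nonneg_iff).2 ⟨_, hg⟩)

theorem IsMeromorphicContinuation.norm_eq {w De : ℂ → ℂ} {ρ ρ' : ℝ}
    (hDe : IsMeromorphicContinuation w ρ ρ' De) {b : ℂ} (hb : ρ' < ‖b‖)
    (h : IsSingularity De b) : ‖b‖ = ρ := by
  by_contra hne
  exact h ⟨De, hDe.analytic b hb hne, EventuallyEq.rfl⟩

/-- Poles are isolated and lie on the compact circle |z| = ρ. -/
theorem IsMeromorphicContinuation.finite_poles {w De : ℂ → ℂ} {ρ ρ' : ℝ}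
    (hDe : IsMeromorphicContinuation w ρ ρ' De) (hρ' : ρ' < ρ) :
    {b : ℂ | ρ' < ‖b‖ ∧ IsPole De b}.Finite := by
  have hsub : {b : ℂ | ρ' < ‖b‖ ∧ IsPole De b} ⊆
      {b | IsPole De b} ∩ Metric.sphere 0 ρ := fun b hb =>
    ⟨hb.2, by simpa using hDe.norm_eq hb.1 hb.2.isSingularity⟩
  refine Set.Finite.subset ?_ hsub
  refine (isCompact_sphere (0 : ℂ) ρ).induction_on (p := fun s => ({b | IsPole De b} ∩ s).Finite)
    (by simp) (fun s t hst ht => ht.subset (Set.inter_subset_inter_right _ hst))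
    (fun s t hs ht => by rw [Set.inter_union_distrib_left]; exact hs.union ht) ?_
  intro x hx
  have hxU : ρ' < ‖x‖ := by rw [mem_sphere_zero_iff_norm.1 hx]; exact hρ'
  have h1 := (hDe.meromorphic x hxU).eventually_analyticAt
  rw [eventually_nhdsWithin_iff] at h1
  refine ⟨_, mem_nhdsWithin_of_mem_nhds h1, (Set.finite_singleton x).subset ?_⟩
  rintro b ⟨hb, hb1⟩
  by_contra hne
  exact hb.isSingularity ⟨De, hb1 hne, EventuallyEq.rfl⟩

/-- Subtracting finitely many principal parts leaves a holomorphic function. -/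
theorem exists_eq_add_principalParts {f : ℂ → ℂ} {U : Set ℂ} (hf : MeromorphicOn f U)
    {P : Finset ℂ} (hP : ∀ b, b ∈ P ↔ b ∈ U ∧ IsPole f b) {m : ℕ}
    (hm : ∀ b ∈ P, poleMultiplicity f b ≤ m) :
    ∃ (c : ℂ → ℕ → ℂ) (R : ℂ → ℂ), AnalyticOnNhd ℂ R U ∧
      (∀ b ∈ P, 1 ≤ m → c b (m - 1) = polarCoeff f m b) ∧
      ∀ z ∈ U, AnalyticAt ℂ f z →
        f z = R z + ∑ b ∈ P, ∑ j ∈ Finset.range m, c b j * ((z - b) ^ (j + 1))⁻¹ := by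
  have hex : ∀ b ∈ P, ∃ (c : ℕ → ℂ) (h : ℂ → ℂ), AnalyticAt ℂ h b ∧
      (1 ≤ m → c (m - 1) = polarCoeff f m b) ∧
      ∀ᶠ z in 𝓝[≠] b, f z = h z + ∑ j ∈ Finset.range m, c j * ((z - b) ^ (j + 1))⁻¹ := by
    intro b hb
    obtain ⟨hbU, hbp⟩ := (hP b).1 hb
    have hle : -(m : ℤ) ≤ meromorphicOrderAt f b := by
      refine le_trans ?_ neg_poleMultiplicity_le
      have := hm b hb
      norm_cast
      omega
    obtain ⟨g, hg, hfg⟩ := exists_analyticAt_mul_pow (hf b hbU) hle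
    obtain ⟨c, h, hh, hc, hfh⟩ := exists_principalPart m hg hfg
    exact ⟨c, h, hh, fun h1 => by rw [hc h1, polarCoeff_eq hg hfg], hfh⟩
  choose! c h hh hc hfh using hex
  set p : ℂ → ℂ → ℂ := fun b z => ∑ j ∈ Finset.range m, c b j * ((z - b) ^ (j + 1))⁻¹ with hp
  have hpan : ∀ b z, z ≠ b → AnalyticAt ℂ (p b) z := by
    intro b z hzb
    refine Finset.analyticAt_fun_sum _ fun j _ => ?_
    exact analyticAt_const.mul (AnalyticAt.inv (by fun_prop) (pow_ne_zero _ (sub_ne_zero.2 hzb)))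
  have hpmer : ∀ b z, MeromorphicAt (p b) z := by
    intro b z
    refine MeromorphicAt.fun_sum fun j _ => ?_
    have hpow : AnalyticAt ℂ (fun y : ℂ => (y - b) ^ (j + 1)) z := by fun_prop
    exact (MeromorphicAt.const _ _).mul hpow.meromorphicAt.inv
  set f1 : ℂ → ℂ := fun z => f z - ∑ b ∈ P, p b z with hf1
  have hf1mer : MeromorphicOn f1 U := fun z hz =>
    (hf z hz).sub (MeromorphicAt.fun_sum fun b _ => hpmer b z)
  have hord : ∀ z ∈ U, 0 ≤ meromorphicOrderAt f1 z := by
    intro z hz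
    refine ((hf1mer z hz).meromorphicOrderAt_nonneg_iff).2 ?_
    by_cases hzP : z ∈ P
    · refine ⟨fun y => h z y - ∑ b ∈ P.erase z, p b y, (hh z hzP).sub
        (Finset.analyticAt_fun_sum _ fun b hb => hpan b z (Finset.ne_of_mem_erase hb).symm), ?_⟩
      filter_upwards [hfh z hzP] with y hy
      simp only [hf1]
      rw [← Finset.add_sum_erase P _ hzP]
      simp only [hp] at hy ⊢
      rw [hy]
      ring
    · have : 0 ≤ meromorphicOrderAt f z := by
        by_contra hlt
        exact hzP ((hP z).2 ⟨hz, hf z hz, not_le.1 hlt⟩)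
      obtain ⟨g, hg, hfg⟩ := ((hf z hz).meromorphicOrderAt_nonneg_iff).1 this
      refine ⟨fun y => g y - ∑ b ∈ P, p b y, hg.sub
        (Finset.analyticAt_fun_sum _ fun b hb => hpan b z (fun h => hzP (h ▸ hb))), ?_⟩
      filter_upwards [hfg] with y hy
      simp only [hf1, hy]
  -- The difference has only removable singularities; its meromorphic normal form fills them in and
  -- leaves the values unchanged wherever f is analytic.
  refine ⟨c, toMeromorphicNFOn f1 U, fun z hz => ?_, hc, fun z hz hfz => ?_⟩
  · refine ((meromorphicNFOn_toMeromorphicNFOn f1 U hz).meromorphicOrderAt_nonneg_iff_analyticAt).1 ?_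
    rw [meromorphicOrderAt_toMeromorphicNFOn hf1mer hz]
    exact hord z hz
  · have hzP : z ∉ P := fun hzP =>
      ((hP z).1 hzP).2.isSingularity ⟨f, hfz, EventuallyEq.rfl⟩
    have hf1an : AnalyticAt ℂ f1 z := hfz.sub
      (Finset.analyticAt_fun_sum _ fun b hb => hpan b z (fun h => hzP (h ▸ hb)))
    rw [toMeromorphicNFOn_eq_toMeromorphicNFAt hf1mer hz,
      toMeromorphicNFAt_eq_self.2 hf1an.meromorphicNFAt, hf1]
    ring

/-! ### Asymptotics of the moments and of the holomorphic remainder. -/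

theorem polarMoment_simple {H : ℂ → ℂ} (hH : DiffContOnCl ℂ H (Metric.ball 0 1)) {a : ℂ}
    (ha : ‖a‖ < 1) (n : ℕ) : polarMoment H a n 1 = H a * a ^ n := by
  have h := polarMoment_succ hH ha n 0
  have h1 := polarMoment_one ha n 0
  rw [zero_add] at h h1
  rw [h, h1, polarMoment_zero_right (diffContOnCl_dslope hH ha)]
  simp

/-- The leading term comes out with C(n, j+1); replacing it by C(n+1, j+1) costs C(n, j), of the
same order as the moment of lower pole order. -/
theorem isBigO_polarMoment_sub {H : ℂ → ℂ} (hH : DiffContOnCl ℂ H (Metric.ball 0 1)) {a : ℂ}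
    (ha0 : a ≠ 0) (ha : ‖a‖ < 1) (j : ℕ) :
    (fun n => polarMoment H a n (j + 2) -
      ((n + 1).choose (j + 1) : ℂ) * a ^ (n - (j + 1)) * H a) =O[atTop]
      fun n : ℕ => (n : ℝ) ^ j * ‖a‖ ^ n := by
  have h1 := isBigO_polarMoment ha0 ha j (diffContOnCl_dslope hH ha)
  have h2 := (isBigO_choose_mul_pow ha0 0 j).const_mul_left (-(H a * a⁻¹))
  refine (h1.add h2).congr' ?_ EventuallyEq.rfl
  filter_upwards [eventually_ge_atTop (j + 1)] with n hn
  have h3 : a ^ (n - j) = a ^ (n - (j + 1)) * a := by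
    rw [← pow_succ]; congr 1; omega
  rw [polarMoment_succ hH ha, polarMoment_one ha, Nat.choose_succ_succ, add_zero, h3]
  push_cast
  field_simp
  ring

/-- The integrand is holomorphic between |z| = s and |z| = 1, so the contour may be moved to |z| =
s. -/
theorem isBigO_circleIntegral_pow_mul {H R : ℂ → ℂ} {ρ' s : ℝ}
    (hH : DiffContOnCl ℂ H (Metric.ball 0 1)) (hR : AnalyticOnNhd ℂ R {z | ρ' < ‖z‖})
    (hs : ρ' < s) (hs0 : 0 < s) (hs1 : s < 1) :
    (fun n : ℕ => (2 * Real.pi * Complex.I)⁻¹ * ∮ z in C(0, 1), z ^ n * H z * R z)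
      =O[atTop] fun n : ℕ => s ^ n := by
  have hann : ∀ z ∈ Metric.closedBall (0 : ℂ) 1 \ Metric.ball 0 s, ρ' < ‖z‖ := fun z hz => by
    have := hz.2
    rw [mem_ball_zero_iff, not_lt] at this
    exact hs.trans_le this
  have hHR : ContinuousOn (fun z => H z * R z)
      (Metric.closedBall (0 : ℂ) 1 \ Metric.ball 0 s) :=
    (hH.continuousOn_ball.mono Set.sdiff_subset).mul
      fun z hz => (hR z (hann z hz)).continuousAt.continuousWithinAt
  have hsph : Metric.sphere (0 : ℂ) s ⊆ Metric.closedBall (0 : ℂ) 1 \ Metric.ball 0 s := by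
    intro z hz
    rw [mem_sphere_zero_iff_norm] at hz
    simp [hz, hs1.le]
  obtain ⟨B, hB⟩ := (isCompact_sphere (0 : ℂ) s).exists_bound_of_continuousOn (hHR.mono hsph)
  refine IsBigO.of_bound (s * B) (Eventually.of_forall fun n => ?_)
  rw [Complex.circleIntegral_eq_of_differentiable_on_annulus_off_countable hs0 hs1.le
    Set.countable_empty]
  · rw [← smul_eq_mul, norm_pow, Real.norm_of_nonneg hs0.le, mul_assoc s]
    refine circleIntegral.norm_two_pi_i_inv_smul_integral_le_of_norm_le_const (E := ℂ) hs0.le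
      fun z hz => ?_
    rw [mul_assoc, norm_mul, norm_pow, mem_sphere_zero_iff_norm.1 hz, mul_comm]
    gcongr
    exact hB z hz
  · refine ((continuousOn_id.pow n).mul hHR).congr fun z _ => ?_
    simp only [Pi.mul_apply, Pi.pow_apply, id, mul_assoc]
  · intro z hz
    have h1 := hH.differentiableAt Metric.isOpen_ball hz.1.1
    have h2 : DifferentiableAt ℂ R z := (hR z (hann z ⟨Metric.ball_subset_closedBall hz.1.1,
      fun h => hz.1.2 (Metric.ball_subset_closedBall h)⟩)).differentiableAt
    fun_prop

theorem circleIntegral_eq_add_polarMoment {H f R : ℂ → ℂ}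
    (hH : DiffContOnCl ℂ H (Metric.ball 0 1)) (hR : ContinuousOn R (Metric.sphere 0 1))
    {P : Finset ℂ} (hP : ∀ b ∈ P, ‖b‖ < 1) {m : ℕ} {c : ℂ → ℕ → ℂ}
    (hf : ∀ z : ℂ, ‖z‖ = 1 →
      f z = R z + ∑ b ∈ P, ∑ j ∈ Finset.range m, c b j * ((z - b) ^ (j + 1))⁻¹) (n : ℕ) :
    (2 * Real.pi * Complex.I)⁻¹ * ∮ z in C(0, 1), z ^ n * H z * f z =
      (2 * Real.pi * Complex.I)⁻¹ * (∮ z in C(0, 1), z ^ n * H z * R z) +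
      ∑ b ∈ P, ∑ j ∈ Finset.range m, c b j * polarMoment H b n (j + 1) := by
  have hHs := hH.continuousOn_sphere
  have hint : ∀ b ∈ P, ∀ j, ContinuousOn
      (fun z => c b j * (z ^ n * H z * ((z - b) ^ (j + 1))⁻¹)) (Metric.sphere 0 1) :=
    fun b hb j => continuousOn_const.mul
      (continuousOn_polarMoment_integrand hHs (hP b hb) n (j + 1))
  have hint2 : ∀ b ∈ P, ContinuousOn (fun z => ∑ j ∈ Finset.range m,
      c b j * (z ^ n * H z * ((z - b) ^ (j + 1))⁻¹)) (Metric.sphere 0 1) :=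
    fun b hb => continuousOn_finsetSum _ fun j _ => hint b hb j
  have hcong : (∮ z in C(0, 1), z ^ n * H z * f z) = ∮ z in C(0, 1), (z ^ n * H z * R z +
      ∑ b ∈ P, ∑ j ∈ Finset.range m, c b j * (z ^ n * H z * ((z - b) ^ (j + 1))⁻¹)) := by
    refine circleIntegral.integral_congr zero_le_one fun z hz => ?_
    simp only [hf z (by simpa using hz), mul_add, Finset.mul_sum]
    congr 1
    refine Finset.sum_congr rfl fun b _ => Finset.sum_congr rfl fun j _ => by ring
  have hHR : CircleIntegrable (fun z => z ^ n * H z * R z) 0 1 :=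
    (((continuousOn_id.pow n).mul hHs).mul hR).circleIntegrable zero_le_one
  rw [hcong, circleIntegral.integral_add hHR
    ((continuousOn_finsetSum P hint2).circleIntegrable zero_le_one), mul_add,
    circleIntegral.integral_fun_sum fun b hb => (hint2 b hb).circleIntegrable zero_le_one,
    Finset.mul_sum]
  congr 1
  refine Finset.sum_congr rfl fun b hb => ?_
  rw [circleIntegral.integral_fun_sum fun j _ => (hint b hb j).circleIntegrable zero_le_one,
    Finset.mul_sum]
  refine Finset.sum_congr rfl fun j _ => ?_
  rw [circleIntegral.integral_const_mul, polarMoment]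
  ring

/-! ### The critical radius and the dominant poles. -/

theorem criticalRadius_lt_one {w : ℂ → ℂ} (h : 0 < criticalRadius w) : criticalRadius w < 1 := by
  rw [criticalRadius] at h ⊢
  set S := {r : ℝ | 0 < r ∧ r < 1 ∧ ∃ g : ℂ → ℂ,
    DifferentiableOn ℂ g {z | r < ‖z‖} ∧ ∀ z : ℂ, 1 < ‖z‖ → g z = szegoFunction w z}
  -- The infimum of the empty set is 0 by convention, so positivity forces the set to be nonempty.
  rcases S.eq_empty_or_nonempty with hS | ⟨r, hr⟩
  · rw [hS, Real.sInf_empty] at h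
    exact absurd h (lt_irrefl 0)
  · exact (csInf_le ⟨0, fun x hx => hx.1.le⟩ hr).trans_lt hr.2.1

theorem criticalRadius_le {w g : ℂ → ℂ} {r : ℝ} (hr0 : 0 < r) (hr1 : r < 1)
    (hg : DifferentiableOn ℂ g {z | r < ‖z‖})
    (hgw : ∀ z : ℂ, 1 < ‖z‖ → g z = szegoFunction w z) : criticalRadius w ≤ r :=
  csInf_le ⟨0, fun _ hx => hx.1.le⟩ ⟨hr0, hr1, g, hg, hgw⟩

/-- Without poles all singularities would be removable, and D_e would continue holomorphically to a
disc exterior of radius below the infimum. -/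
theorem IsMeromorphicContinuation.exists_isPole {w De : ℂ → ℂ} {ρ' : ℝ} (hρ'0 : 0 ≤ ρ')
    (hρ' : ρ' < criticalRadius w)
    (hDe : IsMeromorphicContinuation w (criticalRadius w) ρ' De) :
    ∃ b : ℂ, ρ' < ‖b‖ ∧ IsPole De b := by
  have hρ1 := criticalRadius_lt_one (hρ'0.trans_lt hρ')
  by_contra! hno
  obtain ⟨c, R, hR, -, hDeR⟩ := exists_eq_add_principalParts hDe.meromorphic (P := ∅) (m := 0)
    (fun b => by simpa using hno b) (by simp)
  obtain ⟨r, hr, hr'⟩ := exists_between hρ'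
  refine (criticalRadius_le (hρ'0.trans_lt hr) (hr'.trans hρ1) (g := R) ?_ ?_).not_gt hr'
  · exact fun z hz => (hR z (hr.trans hz)).differentiableAt.differentiableWithinAt
  · intro z hz
    have hzρ := hρ1.trans hz
    rw [← hDe.eq_szego z hz, hDeR z (hρ'.trans hzρ) (hDe.analytic z (hρ'.trans hzρ) hzρ.ne')]
    simp

/-- The dominant poles are the poles of maximal multiplicity. -/
theorem IsMeromorphicContinuation.dominantPoles {w De : ℂ → ℂ} {ρ' : ℝ} (hρ'0 : 0 ≤ ρ')
    (hρ' : ρ' < criticalRadius w)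
    (hDe : IsMeromorphicContinuation w (criticalRadius w) ρ' De) {D : Set ℂ}
    (hD : D = {z | IsDominantPole De {z | ρ' < ‖z‖} z}) {m : ℕ}
    (hm : ∀ z ∈ D, poleMultiplicity De z = m) :
    1 ≤ m ∧ ∀ b : ℂ, ρ' < ‖b‖ → IsPole De b →
      poleMultiplicity De b ≤ m ∧ (poleMultiplicity De b = m → b ∈ D) := by
  have hdom : ∀ b : ℂ, ρ' < ‖b‖ → IsPole De b → (∀ b' : ℂ, ρ' < ‖b'‖ → IsPole De b' →
      poleMultiplicity De b' ≤ poleMultiplicity De b) → b ∈ D := by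
    intro b hb hbp hmax
    rw [hD]
    refine ⟨hb, hbp, fun b' hb' _ hsing => Or.inr ?_⟩
    have hp := isPole_of_isSingularity (hDe.meromorphic b' hb') hsing
    exact ⟨by rw [hDe.norm_eq hb' hsing, hDe.norm_eq hb hbp.isSingularity], hp, hmax b' hb' hp⟩
  -- A pole of maximal multiplicity exists and is dominant, which ties m to an actual multiplicity.
  obtain ⟨b₀, hb₀, hmax⟩ := (hDe.finite_poles hρ').exists_maximalFor (poleMultiplicity De) _
    (hDe.exists_isPole hρ'0 hρ')
  have hmax' : ∀ b' : ℂ, ρ' < ‖b'‖ → IsPole De b' →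
      poleMultiplicity De b' ≤ poleMultiplicity De b₀ := fun b' hb' hp =>
    (le_total (poleMultiplicity De b') (poleMultiplicity De b₀)).elim id
      fun h => hmax ⟨hb', hp⟩ h
  have hb₀m := hm b₀ (hdom b₀ hb₀.1 hb₀.2 hmax')
  rw [hb₀m] at hmax'
  refine ⟨hb₀m ▸ one_le_poleMultiplicity hb₀.2, fun b hb hbp => ⟨hmax' b hb hbp, fun h => ?_⟩⟩
  exact hdom b hb hbp (by rw [h]; exact hmax')


/-! ### Collecting the error terms. -/

theorem isBigO_pow_of_le {x y : ℝ} (hx : 0 ≤ x) (hxy : x ≤ y) :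
    (fun n : ℕ => x ^ n) =O[atTop] fun n : ℕ => y ^ n := by
  refine IsBigO.of_bound 1 (Eventually.of_forall fun n => ?_)
  rw [one_mul, Real.norm_of_nonneg (by positivity), Real.norm_of_nonneg
    (pow_nonneg (hx.trans hxy) n)]
  gcongr

theorem isBigO_conj {f : ℕ → ℂ} {g : ℕ → ℝ} (h : f =O[atTop] g) :
    (fun n => conj (f n)) =O[atTop] g :=
  (h.norm_left.congr_left fun n => (RCLike.norm_conj (f n)).symm).of_norm_left

/-- The difference between the moments of a principal part and their leading term. -/
theorem isBigO_sum_polarMoment_sub {H : ℂ → ℂ} (hH : DiffContOnCl ℂ H (Metric.ball 0 1)) {a : ℂ}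
    (ha0 : a ≠ 0) (ha : ‖a‖ < 1) (c : ℕ → ℂ) (j : ℕ) :
    (fun n => ∑ i ∈ Finset.range (j + 2), c i * polarMoment H a n (i + 1) -
      ((n + 1).choose (j + 1) : ℂ) * (a ^ (n - (j + 1)) * H a * c (j + 1))) =O[atTop]
      fun n : ℕ => (n : ℝ) ^ j * ‖a‖ ^ n := by
  have h1 : (fun n => ∑ i ∈ Finset.range (j + 1), c i * polarMoment H a n (i + 1)) =O[atTop]
      fun n : ℕ => (n : ℝ) ^ j * ‖a‖ ^ n := by
    refine IsBigO.fun_sum fun i hi => ?_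
    exact ((isBigO_polarMoment ha0 ha i hH).trans (isBigO_pow_mul_of_le
      (Nat.lt_succ_iff.1 (Finset.mem_range.1 hi)) _)).const_mul_left _
  refine (h1.add ((isBigO_polarMoment_sub hH ha0 ha j).const_mul_left (c (j + 1)))).congr_left
    fun n => ?_
  rw [Finset.sum_range_succ _ (j + 1)]
  ring

/-- The reduction of the error term to the three sources of error. -/
theorem isBigO_verblunsky_error {w De : ℂ → ℂ} {φ : ℕ → ℂ[X]} {ρ ρ' r s : ℝ}
    (hw : IsAnalyticWeight w) (hφ : IsOrthonormalPolynomials w φ)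
    (hDe : IsMeromorphicContinuation w ρ ρ' De) (hρ'0 : 0 ≤ ρ') (hρ' : ρ' < ρ)
    (hr : ρ < r) (hr1 : r < 1) (hs : ρ' < s) (hs1 : s < 1)
    {P : Finset ℂ} (hP : ∀ b, b ∈ P ↔ ρ' < ‖b‖ ∧ IsPole De b) {ℓ : ℕ} {a : Fin ℓ → ℂ}
    (ha_inj : Function.Injective a) {m : ℕ} (haP : ∀ k, a k ∈ P)
    (hPm : ∀ b ∈ P, poleMultiplicity De b ≤ m + 1)
    (hPa : ∀ b ∈ P, poleMultiplicity De b = m + 1 → b ∈ Set.range a)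
    {β : ℕ → ℝ} (hrβ : (fun n : ℕ => (r ^ 2) ^ n) =O[atTop] β)
    (hsβ : (fun n : ℕ => s ^ n) =O[atTop] β)
    (hPβ : ∀ b ∈ P, ∀ c : ℕ → ℂ, ∀ H : ℂ → ℂ, DiffContOnCl ℂ H (Metric.ball 0 1) →
      (fun n => ∑ i ∈ Finset.range (m + 1), c i * polarMoment H b n (i + 1) -
        ((n + 1).choose m : ℂ) * (b ^ (n - m) * H b * c m)) =O[atTop] β) :
    (fun n : ℕ => verblunsky φ n -
      (-∑ k : Fin ℓ, ((n + 1).choose m : ℂ) *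
        conj (a k ^ (n - m) * szegoFunction w (a k) * polarCoeff De (m + 1) (a k))))
      =O[atTop] β := by
  have hρ0 : 0 < ρ := hρ'0.trans_lt hρ'
  have hρ1 : ρ < 1 := hr.trans hr1
  have hPρ : ∀ b ∈ P, ‖b‖ = ρ := fun b hb =>
    hDe.norm_eq ((hP b).1 hb).1 ((hP b).1 hb).2.isSingularity
  set H : ℂ → ℂ := fun z => (interiorReciprocal w De z)⁻¹ with hHdef
  have hH : DiffContOnCl ℂ H (Metric.ball 0 1) :=
    diffContOnCl_inv_interiorReciprocal hw hDe hρ' hρ0 hρ1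
  obtain ⟨c, R, hR, hc, hDeR⟩ := exists_eq_add_principalParts hDe.meromorphic hP hPm
  have hcirc : ∀ z : ℂ, ‖z‖ = 1 → ρ' < ‖z‖ := fun z hz => by rw [hz]; exact hρ'.trans hρ1
  have hRs : ContinuousOn R (Metric.sphere 0 1) := fun z hz =>
    (hR z (hcirc z (by simpa using hz))).continuousAt.continuousWithinAt
  have hJ := circleIntegral_eq_add_polarMoment hH hRs (fun b hb => (hPρ b hb).trans_lt hρ1)
    fun z hz => hDeR z (hcirc z hz) (hDe.analytic z (hcirc z hz) (by rw [hz]; exact hρ1.ne'))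
  have hreg := isBigO_circleIntegral_pow_mul hH hR hs (hρ'0.trans_lt hs) hs1
  have hver := isBigO_verblunsky_sub hw hφ hDe hρ' hρ0 hr hr1
  have hsum : (fun n => ∑ b ∈ P, (∑ i ∈ Finset.range (m + 1), c b i * polarMoment H b n (i + 1) -
        ((n + 1).choose m : ℂ) * (b ^ (n - m) * H b * c b m))) =O[atTop] β :=
    IsBigO.fun_sum fun b hb => hPβ b hb (c b) H hH
  refine (((hver.trans hrβ).sub (isBigO_conj (hreg.trans hsβ))).sub
    (isBigO_conj hsum)).congr_left fun n => ?_
  -- At poles of lower multiplicity the coefficient of order m + 1 vanishes, so only the dominant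
  -- poles survive.
  have hlead : ∑ b ∈ P, ((n + 1).choose m : ℂ) * (b ^ (n - m) * H b * c b m) =
      ∑ k : Fin ℓ, ((n + 1).choose m : ℂ) *
        (a k ^ (n - m) * szegoFunction w (a k) * polarCoeff De (m + 1) (a k)) := by
    have h1 : ∀ b ∈ P, ((n + 1).choose m : ℂ) * (b ^ (n - m) * H b * c b m) =
        ((n + 1).choose m : ℂ) *
          (b ^ (n - m) * szegoFunction w b * polarCoeff De (m + 1) b) := fun b hb => by
      have hcb := hc b hb (Nat.le_add_left 1 m)
      rw [Nat.add_sub_cancel] at hcb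
      rw [hHdef, hcb]
      simp only
      rw [interiorReciprocal_eq hDe ((hPρ b hb).trans_lt hρ1), inv_inv]
    rw [Finset.sum_congr rfl h1]
    have himg := Finset.sum_image (s := Finset.univ) (g := a) (ha_inj.injOn)
      (f := fun b => ((n + 1).choose m : ℂ) *
          (b ^ (n - m) * szegoFunction w b * polarCoeff De (m + 1) b))
    rw [← himg]
    symm
    refine Finset.sum_subset (Finset.image_subset_iff.2 fun k _ => haP k) fun b hb hba => ?_
    rw [polarCoeff_eq_zero ((hP b).1 hb).2, mul_zero, mul_zero]
    refine (hPm b hb).lt_of_ne fun h => hba ?_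
    obtain ⟨k, rfl⟩ := hPa b hb h
    exact Finset.mem_image_of_mem a (Finset.mem_univ k)
  have hconj : ∑ k : Fin ℓ, ((n + 1).choose m : ℂ) *
        conj (a k ^ (n - m) * szegoFunction w (a k) * polarCoeff De (m + 1) (a k)) =
      conj (∑ b ∈ P, ((n + 1).choose m : ℂ) * (b ^ (n - m) * H b * c b m)) := by
    rw [hlead, map_sum]
    refine Finset.sum_congr rfl fun k _ => ?_
    simp only [map_mul, Complex.conj_natCast]
  have hJn : (∮ z in C(0, 1), z ^ n * (interiorReciprocal w De z)⁻¹ * De z) =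
      ∮ z in C(0, 1), z ^ n * H z * De z := rfl
  rw [hconj, hJn, hJ n, Finset.sum_sub_distrib, map_sub, map_add]
  ring

end Szego

end

theorem mainTheorem6
    (w : ℂ → ℂ) (hw : Szego.IsAnalyticWeight w)
    (φ : ℕ → ℂ[X]) (hφ : Szego.IsOrthonormalPolynomials w φ)
    (ρ ρ' : ℝ) (hρ : ρ = Szego.criticalRadius w) (hρ'_nonneg : 0 ≤ ρ') (hρ' : ρ' < ρ)
    (De : ℂ → ℂ) (hDe : Szego.IsMeromorphicContinuation w ρ ρ' De)
    (ℓ : ℕ) (a : Fin ℓ → ℂ) (ha_inj : Function.Injective a)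
    (ha : Set.range a = {z | Szego.IsDominantPole De {z | ρ' < ‖z‖} z})
    (m : ℕ) (hm : ∀ k, Szego.poleMultiplicity De (a k) = m) :
    (m = 1 → ∃ δ : ℝ, 0 < δ ∧ δ < 1 ∧
      (fun n : ℕ => Szego.verblunsky φ n -
        (-∑ k : Fin ℓ, ((n + 1).choose (m - 1) : ℂ) *
          conj (a k ^ ((n : ℤ) - m + 1) *
            Szego.szegoFunction w (a k) * Szego.polarCoeff De m (a k))))
        =O[atTop] (fun n : ℕ => ρ ^ n * δ ^ n)) ∧
    (2 ≤ m →
      (fun n : ℕ => Szego.verblunsky φ n -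
        (-∑ k : Fin ℓ, ((n + 1).choose (m - 1) : ℂ) *
          conj (a k ^ ((n : ℤ) - m + 1) *
            Szego.szegoFunction w (a k) * Szego.polarCoeff De m (a k))))
        =O[atTop] (fun n : ℕ => (n : ℝ) ^ (m - 2) * ρ ^ n)) := by
  have hρ0 : 0 < ρ := hρ'_nonneg.trans_lt hρ'
  have hρ1 : ρ < 1 := by
    rw [hρ] at hρ0 ⊢; exact Szego.criticalRadius_lt_one hρ0
  obtain ⟨hm1, hdom⟩ := Szego.IsMeromorphicContinuation.dominantPoles hρ'_nonneg (hρ ▸ hρ')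
    (hρ ▸ hDe) ha (m := m) (by rintro _ ⟨k, rfl⟩; exact hm k)
  set P : Finset ℂ := (hDe.finite_poles hρ').toFinset with hPdef
  have hP : ∀ b, b ∈ P ↔ ρ' < ‖b‖ ∧ Szego.IsPole De b := fun b => by
    rw [hPdef, Set.Finite.mem_toFinset]; rfl
  have hPρ : ∀ b ∈ P, ‖b‖ = ρ := fun b hb =>
    hDe.norm_eq ((hP b).1 hb).1 ((hP b).1 hb).2.isSingularity
  have hP0 : ∀ b ∈ P, b ≠ 0 := fun b hb h => by
    have := hPρ b hb
    rw [h, norm_zero] at this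
    exact hρ0.ne this
  have haP : ∀ k, a k ∈ P := fun k => by
    have hk : a k ∈ {z | Szego.IsDominantPole De {z | ρ' < ‖z‖} z} := ha ▸ Set.mem_range_self k
    exact (hP _).2 ⟨hk.1, hk.2.1⟩
  obtain ⟨s, hs, hsρ⟩ := exists_between hρ'
  have hs0 : 0 < s := hρ'_nonneg.trans_lt hs
  -- ρ < r < √ρ: the approximation of F needs r > ρ, and its squared rate must be smaller than ρ.
  obtain ⟨r, hr, hrρ⟩ := exists_between ((Real.lt_sqrt hρ0.le).2 (by nlinarith : ρ ^ 2 < ρ))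
  have hr0 : 0 < r := hρ0.trans hr
  have hr2 : r ^ 2 < ρ := (Real.lt_sqrt hr0.le).1 hrρ
  have hr1 : r < 1 := by nlinarith
  obtain ⟨M, rfl⟩ : ∃ M, m = M + 1 := ⟨m - 1, by omega⟩
  have hzpow : (fun n : ℕ => Szego.verblunsky φ n -
      (-∑ k : Fin ℓ, ((n + 1).choose M : ℂ) *
        conj (a k ^ (n - M) * Szego.szegoFunction w (a k) *
          Szego.polarCoeff De (M + 1) (a k)))) =ᶠ[atTop]
      fun n : ℕ => Szego.verblunsky φ n -
      (-∑ k : Fin ℓ, ((n + 1).choose (M + 1 - 1) : ℂ) *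
        conj (a k ^ ((n : ℤ) - (M + 1 : ℕ) + 1) * Szego.szegoFunction w (a k) *
          Szego.polarCoeff De (M + 1) (a k))) := by
    -- The integer exponent n - m + 1 agrees with the truncated natural subtraction n - M once n ≥
    -- M.
    filter_upwards [eventually_ge_atTop M] with n hn
    have : ((n : ℤ) - (M + 1 : ℕ) + 1) = ((n - M : ℕ) : ℤ) := by push_cast [hn]; ring
    simp only [this, zpow_natCast, Nat.add_sub_cancel]
  have key := fun (β : ℕ → ℝ) h1 h2 h3 => (Szego.isBigO_verblunsky_error hw hφ hDe hρ'_nonneg hρ'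
    hr hr1 hs (hsρ.trans hρ1) hP ha_inj haP (fun b hb => (hdom b ((hP b).1 hb).1 ((hP b).1 hb).2).1)
    (fun b hb => (hdom b ((hP b).1 hb).1 ((hP b).1 hb).2).2) (β := β) h1 h2 h3).congr' hzpow
    EventuallyEq.rfl
  refine ⟨fun h => ?_, fun h => ?_⟩
  · obtain rfl : M = 0 := by omega
    -- The two error rates are s, from the holomorphic remainder, and r², from the orthogonal
    -- polynomials; simple poles contribute no error, their moments being exact.
    refine ⟨max s (r ^ 2) / ρ, by positivity, (div_lt_one hρ0).2 (max_lt hsρ hr2), ?_⟩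
    have hpow : (fun n : ℕ => ρ ^ n * (max s (r ^ 2) / ρ) ^ n) = fun n => max s (r ^ 2) ^ n := by
      ext n
      rw [← mul_pow, mul_div_cancel₀ _ hρ0.ne']
    rw [hpow]
    refine key _ (Szego.isBigO_pow_of_le (sq_nonneg r) (le_max_right _ _))
      (Szego.isBigO_pow_of_le hs0.le (le_max_left _ _)) fun b hb c H hH => ?_
    refine (isBigO_zero _ _).congr_left fun n => ?_
    rw [zero_add, Finset.sum_range_one, zero_add,
      Szego.polarMoment_simple hH ((hPρ b hb).trans_lt hρ1), Nat.choose_zero_right, Nat.sub_zero]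
    push_cast
    ring
  · obtain ⟨j, rfl⟩ : ∃ j, M = j + 1 := ⟨M - 1, by omega⟩
    have hβ : ∀ x : ℝ, 0 ≤ x → x ≤ ρ → (fun n : ℕ => x ^ n) =O[atTop]
        fun n : ℕ => (n : ℝ) ^ (j + 1 + 1 - 2) * ρ ^ n := fun x hx hxρ => by
      refine (Szego.isBigO_pow_of_le hx hxρ).trans ?_
      simpa using Szego.isBigO_pow_mul_of_le (Nat.zero_le (j + 1 + 1 - 2)) ρ
    refine key _ (hβ _ (sq_nonneg r) hr2.le) (hβ _ hs0.le hsρ.le) fun b hb c H hH => ?_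
    have := Szego.isBigO_sum_polarMoment_sub hH (hP0 b hb) ((hPρ b hb).trans_lt hρ1) c j
    rw [hPρ b hb] at this
    exact this
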